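/- Let $1\le K\le N$ and $M$ be integers, let $\sigma_\theta,\sigma_z>0$ with $\sigma_\theta^2+\sigma_z^2=1$, put $\rho=\sigma_\theta^2/\sigma_z^2$, and let $\sigma_{w_1},\sigma_{w_2}>0$ and $\Phi_1,\Phi_2\in\mathbb{R}^{M\times N}$ be fixed. Let $\Theta,Z_1,Z_2$ be random vectors in $\mathbb{R}^N$ and $W_1,W_2$ random vectors in $\mathbb{R}^M$ on a common probability space such that: (i) the support $\mathcal S=\{n:\Theta_n\ne 0\}$ is uniformly distributed over the $\binom NK$ subsets of $\{1,\dots,N\}$ of size $K$; given $\mathcal S$, the vectors $\Theta,Z_1,Z_2$ are independent and vanish outside $\mathcal S$, the entries of $\Theta$ on $\mathcal S$ are i.i.d. $\mathcal N(0,\sigma_\theta^2)$, and those of each $Z_l$ on $\mathcal S$ are i.i.d. $\mathcal N(0,\sigma_z^2)$; (ii) $W_l\sim\mathcal N(0,\sigma_{w_l}^2 I_M)$ for $l=1,2$, $W_1$ and $W_2$ are independent, and $(W_1,W_2)$ is independent of $(\Theta,Z_1,Z_2)$. Let $X_l=\Theta+Z_l$ and $Y_l=\Phi_lX_l+W_l$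 for $l=1,2$, $X=[X_1^\top\ X_2^\top]^\top$ and $Y=[Y_1^\top\ Y_2^\top]^\top$. For a set $s\subset\{1,\dots,N\}$ with $|s|=K$ let $\Phi_{l,s}\in\mathbb{R}^{M\times K}$ consist of the columns of $\Phi_l$ indexed by $s$, and put $$C=\begin{bmatrix}\frac{\rho}{1+\rho}\Phi_{1,s}&\frac1{1+\rho}\Phi_{1,s}&0\\ \frac{\rho}{1+\rho}\Phi_{2,s}&0&\frac1{1+\rho}\Phi_{2,s}\end{bmatrix},\qquad D=\begin{bmatrix}\Phi_{1,s}\Phi_{1,s}^\top+\sigma_{w_1}^2I_M&\frac{\rho}{1+\rho}\Phi_{1,s}\Phi_{2,s}^\top\\ \frac{\rho}{1+\rho}\Phi_{2,s}\Phi_{1,s}^\top&\Phi_{2,s}\Phi_{2,s}^\top+\sigma_{w_2}^2I_M\end{bmatrix},$$ $$\mathbf N=\begin{bmatrix}\sigma_{w_1}^2I_M&0\\0&\sigma_{w_2}^2I_M\end{bmatrix},\qquad E=\begin{bmatrix}\frac{\rho}{1+\rho}I_K&0&0\\0&\frac1{1+\rho}I_K&0\\0&0&\frac1{1+\rho}I_K\end{bmatrix},\qquad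 F=\begin{bmatrix}\Phi_{1,s}&\Phi_{1,s}&0\\ \Phi_{2,s}&0&\Phi_{2,s}\end{bmatrix},$$ $$G=E^{-1}+F^\top \mathbf N^{-1}F,\qquad \beta_s(y)=\exp\Big(\tfrac12\big(y^\top \mathbf N^{-1}F\,G^{-1}F^\top \mathbf N^{-1}y-\ln\det G\big)\Big).$$ Let $\widetilde x^\star(y,s)\in\mathbb{R}^{2N}$ be the vector whose two halves vanish outside $s$ and on $s$ are the two halves of $$\begin{bmatrix}I_K&I_K&0\\I_K&0&I_K\end{bmatrix}C^\top D^{-1}y .$$ Then the following hold. (a) For every $s$ with $|s|=K$ the matrices $D,\mathbf N,E$ are invertible and $\det G>0$; and $\mathbb E\|X_l\|_2^2<\infty$ for $l=1,2$. (b) $\mathbb E[X\mid Y,\mathcal S]=\widetilde x^\star(Y,\mathcal S)$ almost surely. (c) $\mathbb E[X\mid Y]=\widetilde x^\star(Y)$ almost surely, where $$\widetilde x^\star(y)=\frac{\sum_{|s|=K}\beta_s(y)\,\widetilde x^\star(y,s)}{\sum_{|s|=K}\beta_s(y)} .$$ (d) $\widetilde x^\star$ is measurable, and among all measurable estimators $f=(f_1,f_2):\mathbb{R}^{2M}\to\mathbb{R}^N\times\mathbb{R}^N$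 it minimizes the distortion $\frac1{2K}\sum_{l=1}^2\mathbb E\|X_l-f_l(Y)\|_2^2\in[0,\infty]$; every minimizer $f$ satisfies $f(Y)=\widetilde x^\star(Y)$ almost surely. -/

import Mathlib

open MeasureTheory ProbabilityTheory Matrix
open scoped NNReal ENNReal

namespace JSM

/-- The support set of a real vector. -/
noncomputable def supp {N : ℕ} (v : Fin N → ℝ) : Finset (Fin N) :=
  Finset.univ.filter fun n => v n ≠ 0

/-- The law of a random vector of `ℝ^N` whose entries indexed by `s` are i.i.d. `𝒩(0, v)` and
whose other entries are zero. -/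
noncomputable def sparseGaussian {N : ℕ} (s : Finset (Fin N)) (v : ℝ≥0) : Measure (Fin N → ℝ) :=
  Measure.pi fun n => if n ∈ s then gaussianReal 0 v else Measure.dirac 0

/-- The law `𝒩(0, v I_M)` on `ℝ^M`. -/
noncomputable def whiteGaussian (M : ℕ) (v : ℝ≥0) : Measure (Fin M → ℝ) :=
  Measure.pi fun _ => gaussianReal 0 v

/-- The sources `X_l = Θ + Z_l`. -/
def source {Ω : Type*} {N : ℕ} (Θ : Ω → Fin N → ℝ) (Z : Fin 2 → Ω → Fin N → ℝ)
    (l : Fin 2) (ω : Ω) : Fin N → ℝ :=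
  Θ ω + Z l ω

/-- The stacked measurement vector `Y = [Y_1; Y_2]`, where `Y_l = Φ_l X_l + W_l`. -/
def measurement {Ω : Type*} {N M : ℕ} (Φ : Fin 2 → Matrix (Fin M) (Fin N) ℝ)
    (Θ : Ω → Fin N → ℝ) (Z : Fin 2 → Ω → Fin N → ℝ) (W : Fin 2 → Ω → Fin M → ℝ)
    (ω : Ω) : Fin M ⊕ Fin M → ℝ :=
  Sum.elim (Φ 0 *ᵥ source Θ Z 0 ω + W 0 ω) (Φ 1 *ᵥ source Θ Z 1 ω + W 1 ω)

/-- The joint sparsity model with a uniformly drawn support of size `K`, common signal `Θ`,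
innovations `Z 0`, `Z 1` and measurement noises `W 0`, `W 1`. -/
structure IsModel {Ω : Type*} [MeasurableSpace Ω] (P : Measure Ω) {N M : ℕ} (K : ℕ)
    (σθ σz : ℝ≥0) (σw : Fin 2 → ℝ≥0)
    (Θ : Ω → Fin N → ℝ) (Z : Fin 2 → Ω → Fin N → ℝ) (W : Fin 2 → Ω → Fin M → ℝ) : Prop where
  measurable_common : Measurable Θ
  measurable_innovation : ∀ l, Measurable (Z l)
  measurable_noise : ∀ l, Measurable (W l)
  /-- All supports of size `K` are equally likely. -/
  support_uniform : ∀ s : Finset (Fin N), s.card = K →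
    P {ω | supp (Θ ω) = s} = (N.choose K : ℝ≥0∞)⁻¹
  /-- Given the support `s`, the vectors `Θ`, `Z 0`, `Z 1` are independent, vanish outside `s`,
  and have i.i.d. centred Gaussian entries on `s`. -/
  law_given_support : ∀ s : Finset (Fin N), s.card = K →
    (cond P {ω | supp (Θ ω) = s}).map (fun ω => (Θ ω, Z 0 ω, Z 1 ω)) =
      (sparseGaussian s (σθ ^ 2)).prod
        ((sparseGaussian s (σz ^ 2)).prod (sparseGaussian s (σz ^ 2)))
  law_noise : ∀ l, P.map (W l) = whiteGaussian M (σw l ^ 2)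
  indep_noises : IndepFun (W 0) (W 1) P
  indep_sources_noise : IndepFun (fun ω => (Θ ω, Z 0 ω, Z 1 ω)) (fun ω => (W 0 ω, W 1 ω)) P

section ClosedForm

variable {N M : ℕ}

/-- `Φ_{l,s}`: the columns of `Φ_l` indexed by the elements of `s`. -/
def colSub (Φ : Matrix (Fin M) (Fin N) ℝ) (s : Finset (Fin N)) : Matrix (Fin M) s ℝ :=
  Φ.submatrix id Subtype.val

/-- `[I I 0; I 0 I]`. -/
def matA (s : Finset (Fin N)) : Matrix (s ⊕ s) (s ⊕ (s ⊕ s)) ℝ :=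
  fromRows (fromCols 1 (fromCols 1 0)) (fromCols 1 (fromCols 0 1))

/-- `C`. -/
noncomputable def matC (Φ : Fin 2 → Matrix (Fin M) (Fin N) ℝ) (ρ : ℝ) (s : Finset (Fin N)) :
    Matrix (Fin M ⊕ Fin M) (s ⊕ (s ⊕ s)) ℝ :=
  fromRows
    (fromCols ((ρ / (1 + ρ)) • colSub (Φ 0) s) (fromCols ((1 / (1 + ρ)) • colSub (Φ 0) s) 0))
    (fromCols ((ρ / (1 + ρ)) • colSub (Φ 1) s) (fromCols 0 ((1 / (1 + ρ)) • colSub (Φ 1) s)))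

/-- `D`. -/
noncomputable def matD (Φ : Fin 2 → Matrix (Fin M) (Fin N) ℝ) (ρ : ℝ) (σw : Fin 2 → ℝ≥0)
    (s : Finset (Fin N)) : Matrix (Fin M ⊕ Fin M) (Fin M ⊕ Fin M) ℝ :=
  fromBlocks
    (colSub (Φ 0) s * (colSub (Φ 0) s)ᵀ + ((σw 0 : ℝ) ^ 2) • (1 : Matrix (Fin M) (Fin M) ℝ))
    ((ρ / (1 + ρ)) • (colSub (Φ 0) s * (colSub (Φ 1) s)ᵀ))
    ((ρ / (1 + ρ)) • (colSub (Φ 1) s * (colSub (Φ 0) s)ᵀ))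
    (colSub (Φ 1) s * (colSub (Φ 1) s)ᵀ + ((σw 1 : ℝ) ^ 2) • (1 : Matrix (Fin M) (Fin M) ℝ))

/-- `N`. -/
def matN (M : ℕ) (σw : Fin 2 → ℝ≥0) : Matrix (Fin M ⊕ Fin M) (Fin M ⊕ Fin M) ℝ :=
  fromBlocks (((σw 0 : ℝ) ^ 2) • 1) 0 0 (((σw 1 : ℝ) ^ 2) • 1)

/-- `E`. -/
noncomputable def matE (ρ : ℝ) (s : Finset (Fin N)) : Matrix (s ⊕ (s ⊕ s)) (s ⊕ (s ⊕ s)) ℝ :=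
  fromBlocks ((ρ / (1 + ρ)) • 1) 0 0 (fromBlocks ((1 / (1 + ρ)) • 1) 0 0 ((1 / (1 + ρ)) • 1))

/-- `F`. -/
def matF (Φ : Fin 2 → Matrix (Fin M) (Fin N) ℝ) (s : Finset (Fin N)) :
    Matrix (Fin M ⊕ Fin M) (s ⊕ (s ⊕ s)) ℝ :=
  fromRows
    (fromCols (colSub (Φ 0) s) (fromCols (colSub (Φ 0) s) 0))
    (fromCols (colSub (Φ 1) s) (fromCols 0 (colSub (Φ 1) s)))

/-- `G = E⁻¹ + Fᵀ N⁻¹ F`. -/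
noncomputable def matG (Φ : Fin 2 → Matrix (Fin M) (Fin N) ℝ) (ρ : ℝ) (σw : Fin 2 → ℝ≥0)
    (s : Finset (Fin N)) : Matrix (s ⊕ (s ⊕ s)) (s ⊕ (s ⊕ s)) ℝ :=
  (matE ρ s)⁻¹ + (matF Φ s)ᵀ * (matN M σw)⁻¹ * matF Φ s

/-- The weight `β_s = exp (½ (yᵀ N⁻¹ F G⁻¹ Fᵀ N⁻¹ y - ln det G))`. -/
noncomputable def weight (Φ : Fin 2 → Matrix (Fin M) (Fin N) ℝ) (ρ : ℝ) (σw : Fin 2 → ℝ≥0)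
    (y : Fin M ⊕ Fin M → ℝ) (s : Finset (Fin N)) : ℝ :=
  Real.exp (1 / 2 *
    (y ⬝ᵥ (((matN M σw)⁻¹ * matF Φ s * (matG Φ ρ σw s)⁻¹ * (matF Φ s)ᵀ * (matN M σw)⁻¹) *ᵥ y)
      - Real.log (matG Φ ρ σw s).det))

/-- Extension of a vector indexed by `s` by zero outside `s`. -/
def zeroExtend (s : Finset (Fin N)) (v : s → ℝ) (n : Fin N) : ℝ :=
  if h : n ∈ s then v ⟨n, h⟩ else 0

/-- The two components of the estimator for known support `s`: within the support they are the
two blocks of `[I I 0; I 0 I] Cᵀ D⁻¹ y`, otherwise zero. -/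
noncomputable def oracleEstimator (Φ : Fin 2 → Matrix (Fin M) (Fin N) ℝ) (ρ : ℝ)
    (σw : Fin 2 → ℝ≥0) (y : Fin M ⊕ Fin M → ℝ) (s : Finset (Fin N)) : Fin 2 → Fin N → ℝ :=
  ![zeroExtend s fun i =>
      ((matA s * (matC Φ ρ s)ᵀ * (matD Φ ρ σw s)⁻¹) *ᵥ y) (Sum.inl i),
    zeroExtend s fun i =>
      ((matA s * (matC Φ ρ s)ᵀ * (matD Φ ρ σw s)⁻¹) *ᵥ y) (Sum.inr i)]

/-- The weighted average of the known-support estimators over all supports of size `K`. -/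
noncomputable def closedForm (K : ℕ) (Φ : Fin 2 → Matrix (Fin M) (Fin N) ℝ) (ρ : ℝ)
    (σw : Fin 2 → ℝ≥0) (y : Fin M ⊕ Fin M → ℝ) : Fin 2 → Fin N → ℝ :=
  (∑ s ∈ Finset.powersetCard K (Finset.univ : Finset (Fin N)), weight Φ ρ σw y s)⁻¹ •
    ∑ s ∈ Finset.powersetCard K (Finset.univ : Finset (Fin N)),
      weight Φ ρ σw y s • oracleEstimator Φ ρ σw y s

end ClosedForm

/-- The reconstruction distortion `(1/2K) ∑_l 𝔼 ‖X_l - f_l(Y)‖₂²` of an estimator `f`, as a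
number in `[0, ∞]`. -/
noncomputable def distortion {Ω : Type*} [MeasurableSpace Ω] (P : Measure Ω) {N M : ℕ} (K : ℕ)
    (X : Fin 2 → Ω → Fin N → ℝ) (Y : Ω → Fin M ⊕ Fin M → ℝ)
    (f : (Fin M ⊕ Fin M → ℝ) → Fin 2 → Fin N → ℝ) : ℝ≥0∞ :=
  (2 * (K : ℝ≥0∞))⁻¹ *
    ∑ l, ∫⁻ ω, ENNReal.ofReal (‖WithLp.toLp 2 (X l ω - f (Y ω) l)‖ ^ 2) ∂P

end JSM

/-! Given the support `s`, the vector of all coordinates of `(Θ, Z 0, Z 1, W 0, W 1)` consists of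
independent centred Gaussians, with variance zero off `s`, and the sources and measurements are
linear images of it. A linear predictor `L Y` satisfying the normal equations `L Cov(Y) = Cov(X, Y)`
leaves a residual uncorrelated with `Y`, hence independent of it by joint Gaussianity. Here `Cov(Y)
= D`, and on `s` the cross-covariance is `[I I 0; I 0 I] Cᵀ`, which gives the known-support
estimator (`setIntegral_dotProduct_eq_of_uncorrelated`, `covariance_sourceMatrix`).

For unknown support, `P` is the uniform mixture of its conditionings (`IsModel.eq_sum_cond`), so by
Bayes the estimators are averaged with weights proportional to the Gaussian densities of `Y` given
`s`. Writing `D = N + F E Fᵀ`, the Woodbury identity and the matrix determinant lemma split each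
density into a factor common to all `s` of size `K` and the weight `β_s` (`gaussianDensity_matD`).
Conditional means are identified throughout by integrals over events, which are additive over the
mixture.

Optimality and uniqueness are Pythagoras for the conditional mean, in `[0, ∞]` so that no
integrability of the competitor is needed. -/

namespace JSM

/-! ### Linear images of independent centred Gaussians: residuals and characteristic functions. -/

section CentredGaussian

variable {ι κ : Type*} [Fintype ι]

/-- The law of a vector of independent centred Gaussian variables with variances `v`. -/
noncomputable def gaussianPi (v : ι → ℝ≥0) : Measure (ι → ℝ) :=
  Measure.pi fun i => gaussianReal 0 (v i)

/-- Zero variances are allowed, as the coordinates off the support require. -/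
instance isGaussian_gaussianPi (v : ι → ℝ≥0) : IsGaussian (gaussianPi v) := by
  have h := iIndepFun.hasGaussianLaw (P := gaussianPi v) (X := fun (i : ι) (x : ι → ℝ) => x i)
    (fun i => ⟨by
      rw [gaussianPi, (measurePreserving_eval (fun i => gaussianReal 0 (v i)) i).map_eq]
      infer_instance⟩)
    (iIndepFun_pi (μ := fun i => gaussianReal 0 (v i)) (X := fun _ x => x) (by fun_prop))
  simpa using h.isGaussian_map

theorem map_eval_gaussianPi (v : ι → ℝ≥0) (i : ι) :
    (gaussianPi v).map (fun x => x i) = gaussianReal 0 (v i) :=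
  (measurePreserving_eval (fun i => gaussianReal 0 (v i)) i).map_eq

theorem memLp_eval_gaussianPi (v : ι → ℝ≥0) (i : ι) :
    MemLp (fun x => x i) 2 (gaussianPi v) :=
  IsGaussian.memLp_dual (gaussianPi v) (ContinuousLinearMap.proj i) 2 (by simp)

theorem integral_eval_gaussianPi (v : ι → ℝ≥0) (i : ι) : ∫ x, x i ∂gaussianPi v = 0 := by
  have h := integral_map (μ := gaussianPi v) (φ := fun x => x i) (f := fun t : ℝ => t)
    (measurable_pi_apply i).aemeasurable (by fun_prop)
  rw [map_eval_gaussianPi] at h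
  rw [← h]
  exact integral_id_gaussianReal

theorem covariance_eval_gaussianPi [DecidableEq ι] (v : ι → ℝ≥0) (i j : ι) :
    cov[fun x => x i, fun x => x j; gaussianPi v] = if i = j then (v i : ℝ) else 0 := by
  split_ifs with hij
  · subst hij
    rw [covariance_self (measurable_pi_apply i).aemeasurable]
    have h := variance_map (μ := gaussianPi v) (X := fun t : ℝ => t) (Y := fun x : ι → ℝ => x i)
      (by fun_prop) (measurable_pi_apply i).aemeasurable
    rw [map_eval_gaussianPi] at h
    exact h.symm.trans variance_id_gaussianReal
  · have hind := iIndepFun_pi (μ := fun i => gaussianReal 0 (v i)) (X := fun _ x => x)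
      (by fun_prop)
    exact (hind.indepFun hij).covariance_eq_zero (memLp_eval_gaussianPi v i)
      (memLp_eval_gaussianPi v j)

theorem memLp_dotProduct_gaussianPi (v : ι → ℝ≥0) (a : ι → ℝ) :
    MemLp (fun x => a ⬝ᵥ x) 2 (gaussianPi v) := by
  simp only [dotProduct]
  exact memLp_finsetSum _ fun i _ => (memLp_eval_gaussianPi v i).const_mul (a i)

theorem integral_dotProduct_gaussianPi (v : ι → ℝ≥0) (a : ι → ℝ) :
    ∫ x, a ⬝ᵥ x ∂gaussianPi v = 0 := by
  simp only [dotProduct]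
  rw [integral_finsetSum]
  · simp [integral_const_mul, integral_eval_gaussianPi]
  · exact fun i _ => ((memLp_eval_gaussianPi v i).integrable (by norm_num)).const_mul _

theorem covariance_dotProduct_gaussianPi (v : ι → ℝ≥0) (a b : ι → ℝ) :
    cov[fun x => a ⬝ᵥ x, fun x => b ⬝ᵥ x; gaussianPi v] = ∑ i, a i * v i * b i := by
  classical
  simp only [dotProduct]
  rw [covariance_fun_sum_fun_sum (fun i => (memLp_eval_gaussianPi v i).const_mul _)
    (fun i => (memLp_eval_gaussianPi v i).const_mul _)]
  simp only [covariance_const_mul_left, covariance_const_mul_right, covariance_eval_gaussianPi]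
  simp [mul_comm, mul_left_comm]

/-- If `a` is the row of the best linear predictor, i.e. `c ⬝ x - l ⬝ B x` is uncorrelated
with `B x`, then the two have the same integral on every event determined by `B x`. -/
theorem setIntegral_dotProduct_eq_of_uncorrelated [Fintype κ] [DecidableEq ι]
    (v : ι → ℝ≥0) (B : Matrix κ ι ℝ) (c : ι → ℝ) (l : κ → ℝ)
    (h : l ᵥ* (B * diagonal (fun i => (v i : ℝ)) * Bᵀ) =
      c ᵥ* (diagonal (fun i => (v i : ℝ)) * Bᵀ))
    {S : Set (κ → ℝ)} (hS : MeasurableSet S) :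
    ∫ x in (B *ᵥ ·) ⁻¹' S, c ⬝ᵥ x ∂gaussianPi v =
      ∫ x in (B *ᵥ ·) ⁻¹' S, l ⬝ᵥ (B *ᵥ x) ∂gaussianPi v := by
  -- The residual `c ⬝ x - l ⬝ B x` is itself the linear form `a ⬝ x`.
  set a : ι → ℝ := c - l ᵥ* B with ha
  have hBm : Measurable (fun x : ι → ℝ => B *ᵥ x) := by fun_prop
  -- Joint Gaussianity upgrades zero covariance to independence; the `Unit` index only turns the
  -- scalar residual into a family.
  have hgl : HasGaussianLaw (fun x : ι → ℝ =>
      ((fun _ : Unit => a ⬝ᵥ x), fun k => (B *ᵥ x) k)) (gaussianPi v) := by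
    let T : (ι → ℝ) →L[ℝ] (Unit → ℝ) × (κ → ℝ) := LinearMap.toContinuousLinearMap
      ((LinearMap.pi fun _ : Unit => dotProductBilin ℝ ℝ a).prod (mulVecLin B))
    exact ⟨isGaussian_map T⟩
  have hind := hgl.indepFun_of_covariance_eval (X := fun _ x => a ⬝ᵥ x)
    (Y := fun k x => (B *ᵥ x) k) (fun _ k => by
      change cov[fun x => a ⬝ᵥ x, fun x => B k ⬝ᵥ x; gaussianPi v] = 0
      rw [covariance_dotProduct_gaussianPi]
      have hk := congrFun h k
      rw [Matrix.mul_assoc, ← vecMul_vecMul] at hk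
      have : (a ᵥ* (diagonal (fun i => (v i : ℝ)) * Bᵀ)) k = 0 := by
        rw [ha, sub_vecMul, Pi.sub_apply, hk, sub_self]
      rw [← this, ← vecMul_vecMul]
      simp [vecMul, dotProduct, diagonal_apply])
  -- The residual is centred and independent of the indicator of the event, so its integral over the
  -- event vanishes.
  have hind2 : IndepFun (fun x : ι → ℝ => a ⬝ᵥ x)
      (fun x => S.indicator (fun _ => (1 : ℝ)) (B *ᵥ x)) (gaussianPi v) :=
    hind.comp (φ := fun u : Unit → ℝ => u ()) (ψ := S.indicator fun _ => (1 : ℝ))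
      (by fun_prop) (measurable_const.indicator hS)
  have hz := hind2.integral_fun_mul_eq_mul_integral
    (by fun_prop) ((measurable_const.indicator hS).comp hBm).aestronglyMeasurable
  rw [integral_dotProduct_gaussianPi, zero_mul] at hz
  have hz' : ∫ x in (B *ᵥ ·) ⁻¹' S, a ⬝ᵥ x ∂gaussianPi v = 0 := by
    rw [← integral_indicator (hBm hS), ← hz]
    congr 1 with x
    by_cases hx : B *ᵥ x ∈ S <;> simp [Set.indicator, hx]
  have hi : ∀ b : ι → ℝ, Integrable (fun x => b ⬝ᵥ x) (gaussianPi v) := fun b =>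
    (memLp_dotProduct_gaussianPi v b).integrable (by norm_num)
  have h2 : ∀ x : ι → ℝ, a ⬝ᵥ x = c ⬝ᵥ x - (l ᵥ* B) ⬝ᵥ x := fun x => by rw [ha, sub_dotProduct]
  simp only [h2] at hz'
  rw [integral_sub (hi c).integrableOn (hi _).integrableOn, sub_eq_zero] at hz'
  simpa only [dotProduct_mulVec] using hz'

theorem charFunDual_map_mulVec_gaussianPi [Fintype κ] [DecidableEq ι] (v : ι → ℝ≥0)
    (B : Matrix κ ι ℝ) (l : StrongDual ℝ (κ → ℝ)) (lv : κ → ℝ) (hl : ∀ y, l y = lv ⬝ᵥ y) :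
    charFunDual ((gaussianPi v).map (B *ᵥ ·)) l =
      Complex.exp (-((lv ⬝ᵥ ((B * diagonal (fun i => (v i : ℝ)) * Bᵀ) *ᵥ lv) : ℝ) : ℂ) / 2) := by
  let T : (ι → ℝ) →L[ℝ] (κ → ℝ) := LinearMap.toContinuousLinearMap (mulVecLin B)
  change charFunDual ((gaussianPi v).map T) l = _
  rw [charFunDual_map, IsGaussian.charFunDual_eq]
  have h : ∀ x, (l.comp T) x = (lv ᵥ* B) ⬝ᵥ x := fun x => by
    rw [ContinuousLinearMap.comp_apply, hl, ← dotProduct_mulVec]; rfl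
  have h' : ⇑(l.comp T) = fun x => (lv ᵥ* B) ⬝ᵥ x := funext h
  simp only [h']
  rw [← covariance_self (by fun_prop), covariance_dotProduct_gaussianPi, integral_complex_ofReal,
    integral_dotProduct_gaussianPi]
  have : ∑ i, (lv ᵥ* B) i * (v i : ℝ) * (lv ᵥ* B) i =
      lv ⬝ᵥ ((B * diagonal (fun i => (v i : ℝ)) * Bᵀ) *ᵥ lv) := by
    rw [Matrix.mul_assoc, ← mulVec_mulVec, dotProduct_mulVec, ← mulVec_mulVec, mulVec_transpose]
    simp [dotProduct, mulVec_diagonal, mul_assoc]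
  rw [this]
  congr 1
  push_cast
  ring

/-- The characteristic function sees only the covariance. The two index types may differ, so a
rectangular `B` can be traded for a square root of the covariance. -/
theorem map_mulVec_gaussianPi_congr [Fintype κ] {ι' : Type*} [Fintype ι'] [DecidableEq ι]
    [DecidableEq ι'] (v : ι → ℝ≥0) (v' : ι' → ℝ≥0) (B : Matrix κ ι ℝ) (B' : Matrix κ ι' ℝ)
    (h : B * diagonal (fun i => (v i : ℝ)) * Bᵀ = B' * diagonal (fun i => (v' i : ℝ)) * B'ᵀ) :
    (gaussianPi v).map (B *ᵥ ·) = (gaussianPi v').map (B' *ᵥ ·) := by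
  classical
  have := Measure.isFiniteMeasure_map (gaussianPi v) (B *ᵥ ·)
  have := Measure.isFiniteMeasure_map (gaussianPi v') (B' *ᵥ ·)
  refine Measure.ext_of_charFunDual (funext fun l => ?_)
  have hl : ∀ y, l y = (fun k => l (Pi.single k 1)) ⬝ᵥ y := fun y => by
    conv_lhs => rw [← Finset.univ_sum_single y]
    rw [map_sum, dotProduct]
    refine Finset.sum_congr rfl fun k _ => ?_
    rw [show (Pi.single k (y k) : κ → ℝ) = y k • Pi.single k 1 by
      rw [← Pi.single_smul, smul_eq_mul, mul_one], map_smul, smul_eq_mul, mul_comm]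
  rw [charFunDual_map_mulVec_gaussianPi v B l _ hl,
    charFunDual_map_mulVec_gaussianPi v' B' l _ hl, h]

end CentredGaussian

/-! ### Gaussian densities for a nondegenerate covariance matrix. -/

section Density

variable {ι κ : Type*} [Fintype ι] [Fintype κ] [DecidableEq ι] [DecidableEq κ]

/-- The Lebesgue density of the centred Gaussian law with covariance matrix `D`. -/
noncomputable def gaussianDensity (D : Matrix κ κ ℝ) (y : κ → ℝ) : ℝ :=
  ((√(2 * Real.pi)) ^ Fintype.card κ)⁻¹ * (√D.det)⁻¹ * Real.exp (-(y ⬝ᵥ (D⁻¹ *ᵥ y)) / 2)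

theorem measurable_gaussianDensity (D : Matrix κ κ ℝ) : Measurable (gaussianDensity D) := by
  unfold gaussianDensity
  have : Continuous fun y : κ → ℝ => y ⬝ᵥ (D⁻¹ *ᵥ y) := by fun_prop
  fun_prop

theorem gaussianDensity_nonneg (D : Matrix κ κ ℝ) (y : κ → ℝ) : 0 ≤ gaussianDensity D y := by
  unfold gaussianDensity; positivity

theorem prod_gaussianPDFReal_eq (y : κ → ℝ) :
    ∏ k, gaussianPDFReal 0 1 (y k) = gaussianDensity 1 y := by
  simp [gaussianPDFReal, gaussianDensity, Finset.prod_mul_distrib, ← Real.exp_sum,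
    dotProduct, Finset.sum_neg_distrib, Finset.sum_div, neg_div, pow_two, mul_comm, ← inv_pow]

/-- A product measure is determined by its values on boxes, where the integral of the product
density factors. -/
theorem gaussianPi_one_eq_withDensity :
    gaussianPi (fun _ : κ => 1) =
      volume.withDensity fun y => ENNReal.ofReal (gaussianDensity 1 y) := by
  refine Measure.pi_eq fun s hs => ?_
  rw [withDensity_apply _ (MeasurableSet.univ_pi hs)]
  simp only [← prod_gaussianPDFReal_eq]
  have hint : ∀ k, Integrable ((s k).indicator (gaussianPDFReal 0 1)) := fun k =>
    (integrable_gaussianPDFReal 0 1).indicator (hs k)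
  have hind : ∀ y : κ → ℝ, (Set.univ.pi s).indicator (fun y => ∏ k, gaussianPDFReal 0 1 (y k)) y =
      ∏ k, (s k).indicator (gaussianPDFReal 0 1) (y k) := fun y => by
    by_cases hy : y ∈ Set.univ.pi s
    · rw [Set.indicator_of_mem hy]
      exact Finset.prod_congr rfl fun k _ => (Set.indicator_of_mem (hy k trivial) _).symm
    · rw [Set.indicator_of_notMem hy]
      obtain ⟨k, hk⟩ : ∃ k, y k ∉ s k := by simpa [Set.mem_pi] using hy
      exact (Finset.prod_eq_zero (Finset.mem_univ k) (Set.indicator_of_notMem hk _)).symm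
  rw [← ofReal_integral_eq_lintegral_ofReal, ← integral_indicator (MeasurableSet.univ_pi hs)]
  · simp only [hind]
    rw [integral_fintype_prod_volume_eq_prod, ENNReal.ofReal_prod_of_nonneg]
    · refine Finset.prod_congr rfl fun k _ => ?_
      rw [integral_indicator (hs k), gaussianReal_apply_eq_integral _ one_ne_zero]
    · exact fun k _ => integral_nonneg fun t =>
        Set.indicator_nonneg (fun _ _ => gaussianPDFReal_nonneg _ _ _) _
  · exact (Integrable.fintype_prod fun _ => integrable_gaussianPDFReal 0 1).integrableOn
  · exact ae_of_all _ fun y => Finset.prod_nonneg fun k _ => gaussianPDFReal_nonneg _ _ _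

/-- The Jacobian supplies the determinant factor, because `√det(R Rᵀ) = |det R|`, and `‖R⁻¹ y‖²` is
the quadratic form of `(R Rᵀ)⁻¹`. -/
theorem gaussianDensity_one_mulVec_inv (R : Matrix κ κ ℝ) (y : κ → ℝ) :
    |R.det⁻¹| * gaussianDensity 1 (R⁻¹ *ᵥ y) = gaussianDensity (R * Rᵀ) y := by
  have h1 : √(R * Rᵀ).det = |R.det| := by
    rw [det_mul, det_transpose, ← pow_two, Real.sqrt_sq_eq_abs]
  have h2 : (R⁻¹ *ᵥ y) ⬝ᵥ (R⁻¹ *ᵥ y) = y ⬝ᵥ ((R * Rᵀ)⁻¹ *ᵥ y) := by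
    rw [Matrix.mul_inv_rev, ← mulVec_mulVec, ← transpose_nonsing_inv, dotProduct_mulVec y,
      vecMul_transpose]
  simp only [gaussianDensity, h1, h2, inv_one, one_mulVec, det_one, Real.sqrt_one, abs_inv]
  ring

open scoped MatrixOrder in
/-- A nondegenerate linear image of independent centred Gaussian variables has the Gaussian
density. -/
theorem map_mulVec_gaussianPi_eq_withDensity (v : ι → ℝ≥0) (B : Matrix κ ι ℝ)
    (hD : (B * diagonal (fun i => (v i : ℝ)) * Bᵀ).PosDef) :
    (gaussianPi v).map (B *ᵥ ·) = volume.withDensity fun y =>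
      ENNReal.ofReal (gaussianDensity (B * diagonal (fun i => (v i : ℝ)) * Bᵀ) y) := by
  set D := B * diagonal (fun i => (v i : ℝ)) * Bᵀ with hDdef
  obtain ⟨R, hR⟩ : ∃ R : Matrix κ κ ℝ, D = R * Rᵀ := by
    refine ⟨CFC.sqrt D, ?_⟩
    have h : (CFC.sqrt D)ᵀ = CFC.sqrt D := by
      rw [← conjTranspose_eq_transpose_of_trivial]
      exact (CFC.sqrt_nonneg D).isSelfAdjoint
    rw [h, CFC.sqrt_mul_sqrt_self D hD.posSemidef.nonneg]
  have hdet : R.det ≠ 0 := fun h => by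
    have := hD.det_pos
    rw [hR, det_mul, h, zero_mul] at this
    exact lt_irrefl _ this
  -- The law is also that of `R` applied to a standard Gaussian vector; what remains is an
  -- invertible linear change of variables.
  rw [map_mulVec_gaussianPi_congr v (fun _ : κ => 1) B R (by
    rw [← hDdef, hR]; simp), gaussianPi_one_eq_withDensity, hR]
  have hm : Measurable fun y : κ → ℝ => R *ᵥ y := by fun_prop
  have hmi : Measurable fun y : κ → ℝ => R⁻¹ *ᵥ y := by fun_prop
  have hvol := Real.map_matrix_volume_pi_eq_smul_volume_pi hdet
  ext S hS
  rw [Measure.map_apply hm hS, withDensity_apply _ (hm hS), withDensity_apply _ hS]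
  have hg : Measurable fun y => ENNReal.ofReal (gaussianDensity 1 (R⁻¹ *ᵥ y)) :=
    ((measurable_gaussianDensity 1).comp hmi).ennreal_ofReal
  calc ∫⁻ x in (R *ᵥ ·) ⁻¹' S, ENNReal.ofReal (gaussianDensity 1 x)
      = ∫⁻ x in (R *ᵥ ·) ⁻¹' S, ENNReal.ofReal (gaussianDensity 1 (R⁻¹ *ᵥ (R *ᵥ x))) := by
        simp only [mulVec_mulVec, nonsing_inv_mul _ (isUnit_iff_ne_zero.mpr hdet), one_mulVec]
    _ = ∫⁻ y in S, ENNReal.ofReal (gaussianDensity 1 (R⁻¹ *ᵥ y))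
          ∂(volume.map (toLin' R)) := (setLIntegral_map hS hg hm).symm
    _ = ∫⁻ y in S, ENNReal.ofReal |R.det⁻¹| *
          ENNReal.ofReal (gaussianDensity 1 (R⁻¹ *ᵥ y)) := by
        rw [hvol, Measure.restrict_smul, lintegral_smul_measure, lintegral_const_mul _ hg,
          smul_eq_mul]
    _ = ∫⁻ y in S, ENNReal.ofReal (gaussianDensity (R * Rᵀ) y) := by
        simp only [← ENNReal.ofReal_mul (abs_nonneg _), gaussianDensity_one_mulVec_inv R]

end Density

/-! ### Covariances of the model, the normal equations, and the factorization of the density. -/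

section Covariance

variable {N M : ℕ}

/-- The variances of the coordinates of `(Θ, Z 0, Z 1, W 0, W 1)` given the support. -/
def coordVariance (M : ℕ) (σθ σz : ℝ≥0) (σw : Fin 2 → ℝ≥0) (s : Finset (Fin N)) :
    (Fin N ⊕ (Fin N ⊕ Fin N)) ⊕ (Fin M ⊕ Fin M) → ℝ≥0 :=
  Sum.elim
    (Sum.elim (fun n => if n ∈ s then σθ ^ 2 else 0)
      (Sum.elim (fun n => if n ∈ s then σz ^ 2 else 0) (fun n => if n ∈ s then σz ^ 2 else 0)))
    (Sum.elim (fun _ => σw 0 ^ 2) (fun _ => σw 1 ^ 2))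

/-- The matrix of the measurements as a function of `(Θ, Z 0, Z 1, W 0, W 1)`. -/
def measurementMatrix (Φ : Fin 2 → Matrix (Fin M) (Fin N) ℝ) :
    Matrix (Fin M ⊕ Fin M) ((Fin N ⊕ (Fin N ⊕ Fin N)) ⊕ (Fin M ⊕ Fin M)) ℝ :=
  fromCols (fromRows (fromCols (Φ 0) (fromCols (Φ 0) 0)) (fromCols (Φ 1) (fromCols 0 (Φ 1)))) 1

/-- The matrix of the sources as a function of `(Θ, Z 0, Z 1, W 0, W 1)`. -/
def sourceMatrix (N M : ℕ) : Fin 2 →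
    Matrix (Fin N) ((Fin N ⊕ (Fin N ⊕ Fin N)) ⊕ (Fin M ⊕ Fin M)) ℝ :=
  ![fromCols (fromCols 1 (fromCols 1 0)) 0, fromCols (fromCols 1 (fromCols 0 1)) 0]

/-- Extension of a matrix whose rows are indexed by `s` by zero rows outside `s`. -/
noncomputable def rowExtend {κ : Type*} (s : Finset (Fin N)) (A : Matrix s κ ℝ) :
    Matrix (Fin N) κ ℝ :=
  of fun n j => zeroExtend s (fun i => A i j) n

theorem rowExtend_mulVec {κ : Type*} [Fintype κ] (s : Finset (Fin N)) (A : Matrix s κ ℝ)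
    (y : κ → ℝ) : rowExtend s A *ᵥ y = zeroExtend s (A *ᵥ y) := by
  ext n
  by_cases hn : n ∈ s <;> simp [mulVec, dotProduct, rowExtend, zeroExtend, hn]

theorem rowExtend_mul {κ κ' : Type*} [Fintype κ] (s : Finset (Fin N)) (A : Matrix s κ ℝ)
    (B : Matrix κ κ' ℝ) : rowExtend s A * B = rowExtend s (A * B) := by
  ext n j
  by_cases hn : n ∈ s <;> simp [Matrix.mul_apply, rowExtend, zeroExtend, hn]

/-- The matrix of the known-support estimator. -/
noncomputable def oracleMatrix (Φ : Fin 2 → Matrix (Fin M) (Fin N) ℝ) (ρ : ℝ)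
    (σw : Fin 2 → ℝ≥0) (s : Finset (Fin N)) : Fin 2 → Matrix (Fin N) (Fin M ⊕ Fin M) ℝ :=
  ![rowExtend s (toRows₁ (matA s * (matC Φ ρ s)ᵀ) * (matD Φ ρ σw s)⁻¹),
    rowExtend s (toRows₂ (matA s * (matC Φ ρ s)ᵀ) * (matD Φ ρ σw s)⁻¹)]

theorem oracleEstimator_eq_mulVec (Φ : Fin 2 → Matrix (Fin M) (Fin N) ℝ) (ρ : ℝ)
    (σw : Fin 2 → ℝ≥0) (s : Finset (Fin N)) (y : Fin M ⊕ Fin M → ℝ) (l : Fin 2) :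
    oracleEstimator Φ ρ σw y s l = oracleMatrix Φ ρ σw s l *ᵥ y := by
  fin_cases l <;>
    simp only [oracleMatrix, Fin.zero_eta, Fin.mk_one, cons_val_zero, cons_val_one,
      rowExtend_mulVec] <;> rfl

theorem mul_diagonal_mul_apply {ι κ κ' : Type*} [Fintype ι] [DecidableEq ι] (A : Matrix κ ι ℝ)
    (v : ι → ℝ) (B : Matrix ι κ' ℝ) (i : κ) (j : κ') :
    (A * diagonal v * B) i j = ∑ k, A i k * v k * B k j := by
  simp [Matrix.mul_apply (M := A * diagonal v), mul_diagonal]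

/-- In the diagonal blocks common part and innovation add up to variance `σθ² + σz² = 1`; across the
two sensors only `Θ` is shared, with variance `σθ² = ρ / (1 + ρ)`. -/
theorem covariance_measurementMatrix (Φ : Fin 2 → Matrix (Fin M) (Fin N) ℝ) (σθ σz : ℝ≥0)
    (hσ : (σθ : ℝ) ^ 2 + (σz : ℝ) ^ 2 = 1) (ρ : ℝ) (hρ : ρ / (1 + ρ) = (σθ : ℝ) ^ 2)
    (σw : Fin 2 → ℝ≥0) (s : Finset (Fin N)) :
    measurementMatrix Φ * diagonal (fun j => (coordVariance M σθ σz σw s j : ℝ)) *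
      (measurementMatrix Φ)ᵀ = matD Φ ρ σw s := by
  have hz : (σz : ℝ) ^ 2 = 1 - (σθ : ℝ) ^ 2 := by linarith
  ext i j
  rw [mul_diagonal_mul_apply]
  rcases i with i | i <;> rcases j with j | j <;>
    simp [Matrix.mul_apply, measurementMatrix, coordVariance, matD, colSub, hρ, hz, one_apply,
      apply_ite NNReal.toReal, Finset.sum_ite_mem, Finset.mul_sum]
  · rw [Finset.sum_attach s fun n => Φ 0 i n * Φ 0 j n, ← Finset.sum_add_distrib]
    exact Finset.sum_congr rfl fun n _ => by ring
  · rw [Finset.sum_attach s fun n => (σθ : ℝ) ^ 2 * (Φ 0 i n * Φ 1 j n)]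
    exact Finset.sum_congr rfl fun n _ => by ring
  · rw [Finset.sum_attach s fun n => (σθ : ℝ) ^ 2 * (Φ 1 i n * Φ 0 j n)]
    exact Finset.sum_congr rfl fun n _ => by ring
  · rw [Finset.sum_attach s fun n => Φ 1 i n * Φ 1 j n, ← Finset.sum_add_distrib]
    exact Finset.sum_congr rfl fun n _ => by ring

/-- These are the normal equations. `D⁻¹ D` cancels, and the remaining product of `matA` and `Cᵀ` is
the cross-covariance on `s`; off `s` both sides vanish, the source variances there being zero. -/
theorem covariance_sourceMatrix (Φ : Fin 2 → Matrix (Fin M) (Fin N) ℝ) (σθ σz : ℝ≥0) (ρ : ℝ)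
    (hρ : ρ / (1 + ρ) = (σθ : ℝ) ^ 2) (hρ' : 1 / (1 + ρ) = (σz : ℝ) ^ 2)
    (σw : Fin 2 → ℝ≥0) (s : Finset (Fin N)) (hD : IsUnit (matD Φ ρ σw s).det) (l : Fin 2) :
    oracleMatrix Φ ρ σw s l * matD Φ ρ σw s =
      sourceMatrix N M l * diagonal (fun j => (coordVariance M σθ σz σw s j : ℝ)) *
        (measurementMatrix Φ)ᵀ := by
  rw [one_div] at hρ'
  ext n j
  rw [mul_diagonal_mul_apply]
  fin_cases l <;>
    simp only [oracleMatrix, Fin.zero_eta, Fin.mk_one, cons_val_zero, cons_val_one, rowExtend_mul,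
      Matrix.mul_assoc _ _ (matD Φ ρ σw s), nonsing_inv_mul _ hD, Matrix.mul_one] <;>
    rcases j with j | j <;> by_cases hn : n ∈ s <;>
    simp [Matrix.mul_apply, rowExtend, zeroExtend, hn, sourceMatrix, measurementMatrix,
      coordVariance, matA, matC, colSub, one_apply, hρ, hρ']

/-- Noise covariance plus signal covariance, the form to which Woodbury and the determinant lemma
apply. The diagonal blocks use `ρ / (1 + ρ) + 1 / (1 + ρ) = 1`. -/
theorem matD_eq (Φ : Fin 2 → Matrix (Fin M) (Fin N) ℝ) (ρ : ℝ) (hρ : 1 + ρ ≠ 0)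
    (σw : Fin 2 → ℝ≥0) (s : Finset (Fin N)) :
    matD Φ ρ σw s = matN M σw + matF Φ s * matE ρ s * (matF Φ s)ᵀ := by
  ext i j
  rcases i with i | i <;> rcases j with j | j <;>
    simp [Matrix.mul_apply, matD, matF, matE, matN, colSub, one_apply, Finset.mul_sum]
  · rw [add_comm, ← Finset.sum_add_distrib]
    congr 1
    refine Finset.sum_congr rfl fun k _ => ?_
    field_simp
    ring
  · exact Finset.sum_congr rfl fun k _ => by ring
  · exact Finset.sum_congr rfl fun k _ => by ring
  · rw [add_comm, ← Finset.sum_add_distrib]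
    congr 1
    refine Finset.sum_congr rfl fun k _ => ?_
    field_simp
    ring

theorem posDef_matN (σw : Fin 2 → ℝ≥0) (hσw : ∀ l, 0 < σw l) : (matN M σw).PosDef := by
  have : matN M σw = diagonal (Sum.elim (fun _ => (σw 0 : ℝ) ^ 2) fun _ => (σw 1 : ℝ) ^ 2) := by
    rw [matN, smul_one_eq_diagonal, smul_one_eq_diagonal, fromBlocks_diagonal]
  rw [this]
  refine PosDef.diagonal ?_
  have h0 := hσw 0
  have h1 := hσw 1
  rintro (_ | _) <;> simp <;> positivity

theorem matE_eq_diagonal (ρ : ℝ) (s : Finset (Fin N)) : matE ρ s =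
    diagonal (Sum.elim (fun _ => ρ / (1 + ρ)) (Sum.elim (fun _ => 1 / (1 + ρ))
      fun _ => 1 / (1 + ρ))) := by
  simp only [matE, smul_one_eq_diagonal, fromBlocks_diagonal]

theorem posDef_matE {ρ : ℝ} (hρ : 0 < ρ) (s : Finset (Fin N)) : (matE ρ s).PosDef := by
  rw [matE_eq_diagonal]
  refine PosDef.diagonal ?_
  rintro (_ | _ | _) <;> simp <;> positivity

theorem det_matE (ρ : ℝ) (s : Finset (Fin N)) :
    (matE ρ s).det = (ρ / (1 + ρ)) ^ s.card *
      ((1 / (1 + ρ)) ^ s.card * (1 / (1 + ρ)) ^ s.card) := by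
  rw [matE_eq_diagonal, det_diagonal]
  simp only [Fintype.prod_sum_type, Sum.elim_inl, Sum.elim_inr, Finset.prod_const, Finset.card_univ,
    Fintype.card_coe]

theorem posDef_matG (Φ : Fin 2 → Matrix (Fin M) (Fin N) ℝ) {ρ : ℝ} (hρ : 0 < ρ)
    (σw : Fin 2 → ℝ≥0) (hσw : ∀ l, 0 < σw l) (s : Finset (Fin N)) :
    (matG Φ ρ σw s).PosDef := by
  refine (posDef_matE hρ s).inv.add_posSemidef ?_
  have := (posDef_matN (M := M) σw hσw).inv.posSemidef.conjTranspose_mul_mul_same (matF Φ s)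
  rwa [conjTranspose_eq_transpose_of_trivial] at this

theorem posDef_matD (Φ : Fin 2 → Matrix (Fin M) (Fin N) ℝ) {ρ : ℝ} (hρ : 0 < ρ)
    (σw : Fin 2 → ℝ≥0) (hσw : ∀ l, 0 < σw l) (s : Finset (Fin N)) :
    (matD Φ ρ σw s).PosDef := by
  rw [matD_eq Φ ρ (by positivity)]
  refine (posDef_matN σw hσw).add_posSemidef ?_
  have := (posDef_matE hρ s).posSemidef.mul_mul_conjTranspose_same (matF Φ s)
  rwa [conjTranspose_eq_transpose_of_trivial] at this

theorem inv_matD (Φ : Fin 2 → Matrix (Fin M) (Fin N) ℝ) {ρ : ℝ} (hρ : 0 < ρ)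
    (σw : Fin 2 → ℝ≥0) (hσw : ∀ l, 0 < σw l) (s : Finset (Fin N)) :
    (matD Φ ρ σw s)⁻¹ = (matN M σw)⁻¹ -
      (matN M σw)⁻¹ * matF Φ s * (matG Φ ρ σw s)⁻¹ * (matF Φ s)ᵀ * (matN M σw)⁻¹ := by
  rw [matD_eq Φ ρ (by positivity), add_mul_mul_inv_eq_sub _ _ _ _ (posDef_matN σw hσw).isUnit
    (posDef_matE hρ s).isUnit (posDef_matG Φ hρ σw hσw s).isUnit, matG]

/-- The determinant lemma leaves `det (1 + E Fᵀ N⁻¹ F)`, and factoring out `E` turns the argument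
into `E G`. -/
theorem det_matD (Φ : Fin 2 → Matrix (Fin M) (Fin N) ℝ) {ρ : ℝ} (hρ : 0 < ρ)
    (σw : Fin 2 → ℝ≥0) (hσw : ∀ l, 0 < σw l) (s : Finset (Fin N)) :
    (matD Φ ρ σw s).det = (matN M σw).det * (matE ρ s).det * (matG Φ ρ σw s).det := by
  have hE := isUnit_iff_isUnit_det _ |>.mp (posDef_matE hρ s).isUnit
  rw [matD_eq Φ ρ (by positivity), Matrix.mul_assoc,
    det_add_mul _ _ (isUnit_iff_isUnit_det _ |>.mp (posDef_matN σw hσw).isUnit), _root_.mul_assoc,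
    ← det_mul, matG, Matrix.mul_add, mul_nonsing_inv _ hE]
  simp only [Matrix.mul_assoc]

/-- The density of the measurements given the support `s` is the weight of `s`, up to a factor
which does not depend on `s`. -/
theorem gaussianDensity_matD (Φ : Fin 2 → Matrix (Fin M) (Fin N) ℝ) {ρ : ℝ} (hρ : 0 < ρ)
    (σw : Fin 2 → ℝ≥0) (hσw : ∀ l, 0 < σw l) (K : ℕ) (y : Fin M ⊕ Fin M → ℝ) :
    ∃ c : ℝ, 0 < c ∧ ∀ s : Finset (Fin N), s.card = K →
      gaussianDensity (matD Φ ρ σw s) y = c * weight Φ ρ σw y s := by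
  have hN := (posDef_matN (M := M) σw hσw).det_pos
  -- The constant collects the power of `2π`, the determinants of `N` and `E`, and the part `yᵀ N⁻¹
  -- y` of the exponent. The determinant of `E` depends on `s` only through its size `K`.
  refine ⟨((√(2 * Real.pi)) ^ Fintype.card (Fin M ⊕ Fin M))⁻¹ *
    (√((matN M σw).det * ((ρ / (1 + ρ)) ^ K * ((1 / (1 + ρ)) ^ K * (1 / (1 + ρ)) ^ K))))⁻¹ *
    Real.exp (-(y ⬝ᵥ ((matN M σw)⁻¹ *ᵥ y)) / 2), by positivity, ?_⟩
  rintro s rfl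
  have hG := (posDef_matG Φ hρ σw hσw s).det_pos
  rw [gaussianDensity, det_matD Φ hρ σw hσw, inv_matD Φ hρ σw hσw, weight, det_matE,
    Real.sqrt_mul (x := (matN M σw).det * _) (by positivity) (matG Φ ρ σw s).det,
    sub_mulVec, dotProduct_sub, mul_sub, Real.exp_sub,
    show Real.exp (1 / 2 * Real.log (matG Φ ρ σw s).det) = √(matG Φ ρ σw s).det by
      rw [Real.sqrt_eq_rpow, Real.rpow_def_of_pos hG, mul_comm],
    mul_inv, div_eq_mul_inv (Real.exp _)]
  rw [neg_sub, sub_div, Real.exp_sub, neg_div, Real.exp_neg, div_eq_mul_inv (Real.exp _), one_div,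
    inv_mul_eq_div]
  ring_nf

theorem weight_pos (Φ : Fin 2 → Matrix (Fin M) (Fin N) ℝ) (ρ : ℝ) (σw : Fin 2 → ℝ≥0)
    (y : Fin M ⊕ Fin M → ℝ) (s : Finset (Fin N)) : 0 < weight Φ ρ σw y s := Real.exp_pos _

theorem continuous_weight (Φ : Fin 2 → Matrix (Fin M) (Fin N) ℝ) (ρ : ℝ) (σw : Fin 2 → ℝ≥0)
    (s : Finset (Fin N)) : Continuous fun y => weight Φ ρ σw y s := by
  unfold weight
  fun_prop

theorem continuous_oracleEstimator (Φ : Fin 2 → Matrix (Fin M) (Fin N) ℝ) (ρ : ℝ)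
    (σw : Fin 2 → ℝ≥0) (s : Finset (Fin N)) :
    Continuous fun y => oracleEstimator Φ ρ σw y s := by
  refine continuous_pi fun l => ?_
  simp only [oracleEstimator_eq_mulVec]
  fun_prop

theorem measurable_closedForm (K : ℕ) (Φ : Fin 2 → Matrix (Fin M) (Fin N) ℝ) (ρ : ℝ)
    (σw : Fin 2 → ℝ≥0) : Measurable (closedForm K Φ ρ σw) := by
  unfold closedForm
  refine Measurable.smul (Measurable.inv (f := fun y => ∑ s ∈ Finset.powersetCard K
    (Finset.univ : Finset (Fin N)), weight Φ ρ σw y s) ?_) ?_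
  · exact Finset.measurable_fun_sum _ fun s _ => (continuous_weight Φ ρ σw s).measurable
  · exact Finset.measurable_fun_sum _ fun s _ => (continuous_weight Φ ρ σw s).measurable.smul
      (continuous_oracleEstimator Φ ρ σw s).measurable

end Covariance

/-! ### The law of the coordinates given the support, and the mixture over supports. -/

section Model

variable {N M : ℕ}

theorem measurable_supp : Measurable[_, ⊤] (supp : (Fin N → ℝ) → Finset (Fin N)) := by
  refine @measurable_to_countable' _ _ ⊤ _ _ _ fun s => ?_
  have : (supp : (Fin N → ℝ) → Finset (Fin N)) ⁻¹' {s} =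
      ⋂ n, {v | v n ≠ 0 ↔ n ∈ s} := by
    ext v
    simp [supp, Finset.ext_iff]
  rw [this]
  refine MeasurableSet.iInter fun n => ?_
  have h0 : MeasurableSet {v : Fin N → ℝ | v n ≠ 0} :=
    (measurable_pi_apply n) (measurableSet_singleton 0).compl
  by_cases hn : n ∈ s
  · simpa [hn] using h0
  · simpa [hn, Set.compl_def] using h0.compl

/-- The Dirac mass at zero is the Gaussian law of variance zero. -/
theorem sparseGaussian_eq_gaussianPi (s : Finset (Fin N)) (v : ℝ≥0) :
    sparseGaussian s v = gaussianPi fun n => if n ∈ s then v else 0 := by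
  unfold sparseGaussian gaussianPi
  congr 1
  funext n
  by_cases hn : n ∈ s <;> simp [hn]

theorem map_sumElim_gaussianPi_prod {ι κ : Type*} [Fintype ι] [Fintype κ] (v : ι → ℝ≥0)
    (w : κ → ℝ≥0) : ((gaussianPi v).prod (gaussianPi w)).map (fun p => Sum.elim p.1 p.2) =
      gaussianPi (Sum.elim v w) := by
  have h := (measurePreserving_sumPiEquivProdPi_symm
    (fun i : ι ⊕ κ => gaussianReal 0 (Sum.elim v w i))).map_eq
  unfold gaussianPi
  rw [← h]
  congr 1

theorem measurable_sumElim {α ι κ : Type*} [MeasurableSpace α] {f : α → ι → ℝ} {g : α → κ → ℝ}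
    (hf : Measurable f) (hg : Measurable g) : Measurable fun a => Sum.elim (f a) (g a) := by
  refine measurable_pi_lambda _ fun i => ?_
  cases i with
  | inl i => exact (measurable_pi_apply i).comp hf
  | inr i => exact (measurable_pi_apply i).comp hg

/-- Conditioning on an event determined by `T` does not affect the law of an independent `U`. -/
theorem map_prod_cond_of_indepFun {Ω α β : Type*} [MeasurableSpace Ω] [MeasurableSpace α]
    [MeasurableSpace β] {P : Measure Ω} [IsProbabilityMeasure P] {T : Ω → α} {U : Ω → β}
    (hT : Measurable T) (hU : Measurable U) (h : IndepFun T U P) {A : Set α}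
    (hA : MeasurableSet A) :
    (cond P (T ⁻¹' A)).map (fun ω => (T ω, U ω)) =
      ((cond P (T ⁻¹' A)).map T).prod (P.map U) := by
  have := Measure.isProbabilityMeasure_map (μ := P) hU.aemeasurable
  refine (Measure.prod_eq fun s t hs ht => ?_).symm
  rw [Measure.map_apply (hT.prodMk hU) (hs.prod ht), Measure.map_apply hT hs,
    Measure.map_apply hU ht, cond_apply (hT hA), cond_apply (hT hA), mul_assoc]
  congr 1
  have h1 : T ⁻¹' A ∩ (fun ω => (T ω, U ω)) ⁻¹' s ×ˢ t = T ⁻¹' (A ∩ s) ∩ U ⁻¹' t := by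
    ext ω; simp [and_assoc]
  rw [h1, h.measure_inter_preimage_eq_mul _ _ (hA.inter hs) ht, Set.preimage_inter]

/-- The coordinates of `(Θ, Z 0, Z 1, W 0, W 1)`. -/
def coords {Ω : Type*} (Θ : Ω → Fin N → ℝ) (Z : Fin 2 → Ω → Fin N → ℝ)
    (W : Fin 2 → Ω → Fin M → ℝ) (ω : Ω) : (Fin N ⊕ (Fin N ⊕ Fin N)) ⊕ (Fin M ⊕ Fin M) → ℝ :=
  Sum.elim (Sum.elim (Θ ω) (Sum.elim (Z 0 ω) (Z 1 ω))) (Sum.elim (W 0 ω) (W 1 ω))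

theorem measurement_eq_mulVec {Ω : Type*} (Φ : Fin 2 → Matrix (Fin M) (Fin N) ℝ)
    (Θ : Ω → Fin N → ℝ) (Z : Fin 2 → Ω → Fin N → ℝ) (W : Fin 2 → Ω → Fin M → ℝ) (ω : Ω) :
    measurement Φ Θ Z W ω = measurementMatrix Φ *ᵥ coords Θ Z W ω := by
  ext i
  rcases i with i | i <;>
    simp [measurement, measurementMatrix, coords, source, fromCols_mulVec, fromBlocks_mulVec,
      mulVec_add]

theorem source_eq_mulVec {Ω : Type*} (Θ : Ω → Fin N → ℝ) (Z : Fin 2 → Ω → Fin N → ℝ)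
    (W : Fin 2 → Ω → Fin M → ℝ) (l : Fin 2) (ω : Ω) :
    source Θ Z l ω = sourceMatrix N M l *ᵥ coords Θ Z W ω := by
  fin_cases l <;> simp [source, sourceMatrix, coords, fromCols_mulVec]

variable {Ω : Type*} [MeasurableSpace Ω] {P : Measure Ω} [IsProbabilityMeasure P] {K : ℕ}
  {σθ σz : ℝ≥0} {σw : Fin 2 → ℝ≥0}
  {Θ : Ω → Fin N → ℝ} {Z : Fin 2 → Ω → Fin N → ℝ} {W : Fin 2 → Ω → Fin M → ℝ}

omit [IsProbabilityMeasure P] in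
theorem IsModel.measurable_coords (h : IsModel P K σθ σz σw Θ Z W) :
    Measurable (coords Θ Z W) :=
  measurable_sumElim
    (measurable_sumElim h.measurable_common
      (measurable_sumElim (h.measurable_innovation 0) (h.measurable_innovation 1)))
    (measurable_sumElim (h.measurable_noise 0) (h.measurable_noise 1))

omit [IsProbabilityMeasure P] in
theorem IsModel.measurable_measurement (h : IsModel P K σθ σz σw Θ Z W)
    (Φ : Fin 2 → Matrix (Fin M) (Fin N) ℝ) : Measurable (measurement Φ Θ Z W) := by
  have := h.measurable_coords
  rw [funext (measurement_eq_mulVec Φ Θ Z W)]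
  fun_prop

omit [IsProbabilityMeasure P] in
theorem IsModel.measurableSet_support (h : IsModel P K σθ σz σw Θ Z W) (s : Finset (Fin N)) :
    MeasurableSet {ω | supp (Θ ω) = s} :=
  h.measurable_common (measurable_supp (show MeasurableSet[⊤] {s} from trivial))

/-- The support event is determined by the sources, so conditioning on it preserves the noise law
and its independence of the sources. The nested products of Gaussian laws then flatten into one. -/
theorem IsModel.map_coords_cond (h : IsModel P K σθ σz σw Θ Z W) {s : Finset (Fin N)}
    (hs : s.card = K) :
    (cond P {ω | supp (Θ ω) = s}).map (coords Θ Z W) =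
      gaussianPi (coordVariance M σθ σz σw s) := by
  have hΘ := h.measurable_common
  have hZ := h.measurable_innovation
  have hW := h.measurable_noise
  have hA : MeasurableSet {p : (Fin N → ℝ) × (Fin N → ℝ) × (Fin N → ℝ) | supp p.1 = s} :=
    measurable_fst (measurable_supp (show MeasurableSet[⊤] {s} from trivial))
  have hjoint := map_prod_cond_of_indepFun (hΘ.prodMk ((hZ 0).prodMk (hZ 1)))
    ((hW 0).prodMk (hW 1)) h.indep_sources_noise hA
  change (cond P {ω | supp (Θ ω) = s}).map _ = ((cond P {ω | supp (Θ ω) = s}).map _).prod _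
    at hjoint
  have hnoise := (indepFun_iff_map_prod_eq_prod_map_map (hW 0).aemeasurable
    (hW 1).aemeasurable).mp h.indep_noises
  have hwhite : ∀ v, whiteGaussian M v = gaussianPi fun _ => v := fun _ => rfl
  rw [h.law_noise 0, h.law_noise 1, hwhite, hwhite] at hnoise
  have hsrc := h.law_given_support s hs
  simp only [sparseGaussian_eq_gaussianPi] at hsrc
  have e1 : (fun p : (Fin N → ℝ) × (Fin N → ℝ) × (Fin N → ℝ) =>
      Sum.elim p.1 (Sum.elim p.2.1 p.2.2)) =
      (fun p : (Fin N → ℝ) × (Fin N ⊕ Fin N → ℝ) => Sum.elim p.1 p.2) ∘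
        (Prod.map id fun p => Sum.elim p.1 p.2) := rfl
  have hm2 : ∀ {ι κ : Type}, Measurable fun p : (ι → ℝ) × (κ → ℝ) => Sum.elim p.1 p.2 :=
    fun {_ _} => measurable_sumElim measurable_fst measurable_snd
  -- Factoring `coords` through nested pairs lets the pushforward pass inside each product measure.
  have e2 : coords Θ Z W = (fun p : (Fin N ⊕ (Fin N ⊕ Fin N) → ℝ) × (Fin M ⊕ Fin M → ℝ) =>
      Sum.elim p.1 p.2) ∘ Prod.map
        (fun p : (Fin N → ℝ) × (Fin N → ℝ) × (Fin N → ℝ) => Sum.elim p.1 (Sum.elim p.2.1 p.2.2))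
        (fun p : (Fin M → ℝ) × (Fin M → ℝ) => Sum.elim p.1 p.2) ∘
      (fun ω => ((Θ ω, Z 0 ω, Z 1 ω), (W 0 ω, W 1 ω))) := rfl
  have hm3 : Measurable (fun p : (Fin N → ℝ) × (Fin N → ℝ) × (Fin N → ℝ) =>
      Sum.elim p.1 (Sum.elim p.2.1 p.2.2)) := by
    rw [e1]; exact hm2.comp (measurable_id.prodMap hm2)
  rw [e2, ← Measure.map_map hm2 ((hm3.prodMap hm2).comp (by fun_prop)),
    ← Measure.map_map (hm3.prodMap hm2) (by fun_prop), hjoint, hsrc, hnoise,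
    ← Measure.map_prod_map _ _ hm3 hm2, e1, ← Measure.map_map hm2 (measurable_id.prodMap hm2),
    ← Measure.map_prod_map _ _ measurable_id hm2, Measure.map_id]
  simp only [map_sumElim_gaussianPi_prod]
  rfl

theorem choose_inv_ne_top (hKN : K ≤ N) : ((N.choose K : ℝ≥0∞)⁻¹) ≠ ⊤ :=
  ENNReal.inv_ne_top.mpr (by exact_mod_cast (Nat.choose_pos hKN).ne')

/-- The underlying probability is the uniform mixture of its conditionings on the support. -/
theorem IsModel.eq_sum_cond (h : IsModel P K σθ σz σw Θ Z W) (hKN : K ≤ N) :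
    P = ∑ s ∈ Finset.powersetCard K (Finset.univ : Finset (Fin N)),
      (N.choose K : ℝ≥0∞)⁻¹ • cond P {ω | supp (Θ ω) = s} := by
  set I := Finset.powersetCard K (Finset.univ : Finset (Fin N)) with hI
  have hcard : ∀ s ∈ I, s.card = K := fun s hs => (Finset.mem_powersetCard.mp hs).2
  have hdisj : (I : Set (Finset (Fin N))).PairwiseDisjoint fun s => {ω | supp (Θ ω) = s} :=
    fun s _ t _ hst => Set.disjoint_left.mpr fun ω hs ht => hst (hs.symm.trans ht)
  have hne : (N.choose K : ℝ≥0∞) ≠ 0 := by exact_mod_cast (Nat.choose_pos hKN).ne'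
  -- The supports of size `K` already exhaust the total mass, so every other support is null.
  have hone : P (⋃ s ∈ I, {ω | supp (Θ ω) = s}) = 1 := by
    rw [measure_biUnion_finset hdisj fun s _ => h.measurableSet_support s,
      Finset.sum_congr rfl fun s hs => h.support_uniform s (hcard s hs), Finset.sum_const, hI,
      Finset.card_powersetCard, Finset.card_univ, Fintype.card_fin, nsmul_eq_mul,
      ENNReal.mul_inv_cancel hne (ENNReal.natCast_ne_top _)]
  have hU : MeasurableSet (⋃ s ∈ I, {ω | supp (Θ ω) = s}) :=
    I.measurableSet_biUnion fun s _ => h.measurableSet_support s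
  ext A hA
  rw [Measure.finsetSum_apply, ← measure_inter_add_sdiff A hU,
    measure_mono_null (Set.sdiff_subset_compl _ _) ((prob_compl_eq_zero_iff hU).mpr hone), add_zero,
    Set.inter_iUnion₂, measure_biUnion_finset
      (fun s hs t ht hst => (hdisj hs ht hst).mono Set.inter_subset_right Set.inter_subset_right)
      fun s _ => hA.inter (h.measurableSet_support s)]
  refine Finset.sum_congr rfl fun s hs => ?_
  rw [Measure.smul_apply, cond_apply (h.measurableSet_support s), h.support_uniform s (hcard s hs),
    inv_inv, smul_eq_mul, ← mul_assoc, ENNReal.inv_mul_cancel hne (ENNReal.natCast_ne_top _),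
    one_mul, Set.inter_comm]

theorem IsModel.integrable_of_cond (h : IsModel P K σθ σz σw Θ Z W) (hKN : K ≤ N) {f : Ω → ℝ}
    (hf : ∀ s : Finset (Fin N), s.card = K → Integrable f (cond P {ω | supp (Θ ω) = s})) :
    Integrable f P := by
  rw [h.eq_sum_cond hKN, integrable_finsetSum_measure]
  exact fun s hs => (hf s (Finset.mem_powersetCard.mp hs).2).smul_measure (choose_inv_ne_top hKN)

theorem IsModel.memLp_two_of_cond (h : IsModel P K σθ σz σw Θ Z W) (hKN : K ≤ N) {f : Ω → ℝ}
    (hm : Measurable f)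
    (hf : ∀ s : Finset (Fin N), s.card = K → MemLp f 2 (cond P {ω | supp (Θ ω) = s})) :
    MemLp f 2 P :=
  (memLp_two_iff_integrable_sq hm.aestronglyMeasurable).mpr
    (h.integrable_of_cond hKN fun s hs => (hf s hs).integrable_sq)

theorem IsModel.setIntegral_eq_sum_cond (h : IsModel P K σθ σz σw Θ Z W) (hKN : K ≤ N)
    {f : Ω → ℝ}
    (hf : ∀ s : Finset (Fin N), s.card = K → Integrable f (cond P {ω | supp (Θ ω) = s}))
    {A : Set Ω} (hA : MeasurableSet A) :
    ∫ ω in A, f ω ∂P = ((N.choose K : ℝ≥0∞)⁻¹).toReal *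
      ∑ s ∈ Finset.powersetCard K (Finset.univ : Finset (Fin N)),
        ∫ ω in A, f ω ∂(cond P {ω | supp (Θ ω) = s}) := by
  rw [← integral_indicator hA]
  nth_rw 1 [h.eq_sum_cond hKN]
  rw [integral_finsetSum_measure fun s hs =>
    ((hf s (Finset.mem_powersetCard.mp hs).2).indicator hA).smul_measure (choose_inv_ne_top hKN),
    Finset.mul_sum]
  refine Finset.sum_congr rfl fun s _ => ?_
  rw [integral_smul_measure, integral_indicator hA, smul_eq_mul]

end Model

/-! ### Conditional means with known and with unknown support. -/

section ConditionalMean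

variable {N M : ℕ} {Ω : Type*} [MeasurableSpace Ω] {P : Measure Ω} [IsProbabilityMeasure P]
  {K : ℕ} {σθ σz : ℝ≥0} {σw : Fin 2 → ℝ≥0}
  {Θ : Ω → Fin N → ℝ} {Z : Fin 2 → Ω → Fin N → ℝ} {W : Fin 2 → Ω → Fin M → ℝ} {ρ : ℝ}

theorem IsModel.memLp_dotProduct_coords (h : IsModel P K σθ σz σw Θ Z W) {s : Finset (Fin N)}
    (hs : s.card = K) (a : (Fin N ⊕ (Fin N ⊕ Fin N)) ⊕ (Fin M ⊕ Fin M) → ℝ) :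
    MemLp (fun ω => a ⬝ᵥ coords Θ Z W ω) 2 (cond P {ω | supp (Θ ω) = s}) := by
  have := memLp_dotProduct_gaussianPi (coordVariance M σθ σz σw s) a
  rw [← h.map_coords_cond hs] at this
  exact this.comp_of_map h.measurable_coords.aemeasurable

theorem IsModel.memLp_source_cond (h : IsModel P K σθ σz σw Θ Z W) {s : Finset (Fin N)}
    (hs : s.card = K) (l : Fin 2) (n : Fin N) :
    MemLp (fun ω => source Θ Z l ω n) 2 (cond P {ω | supp (Θ ω) = s}) := by
  simp only [source_eq_mulVec Θ Z W l]
  exact h.memLp_dotProduct_coords hs _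

/-- The support `t` of the estimator need not be the true `s`: the weighted average uses every `t`
under each conditional law. -/
theorem IsModel.memLp_oracleEstimator_cond (h : IsModel P K σθ σz σw Θ Z W)
    (Φ : Fin 2 → Matrix (Fin M) (Fin N) ℝ) (ρ : ℝ) {s : Finset (Fin N)} (hs : s.card = K)
    (t : Finset (Fin N)) (l : Fin 2) (n : Fin N) :
    MemLp (fun ω => oracleEstimator Φ ρ σw (measurement Φ Θ Z W ω) t l n) 2
      (cond P {ω | supp (Θ ω) = s}) := by
  simp only [oracleEstimator_eq_mulVec, measurement_eq_mulVec, mulVec_mulVec]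
  exact h.memLp_dotProduct_coords hs _

theorem closedForm_apply (K : ℕ) (Φ : Fin 2 → Matrix (Fin M) (Fin N) ℝ) (ρ : ℝ)
    (σw : Fin 2 → ℝ≥0) (y : Fin M ⊕ Fin M → ℝ) (l : Fin 2) (n : Fin N) :
    closedForm K Φ ρ σw y l n =
      (∑ s ∈ Finset.powersetCard K (Finset.univ : Finset (Fin N)), weight Φ ρ σw y s)⁻¹ *
        ∑ s ∈ Finset.powersetCard K (Finset.univ : Finset (Fin N)),
          weight Φ ρ σw y s * oracleEstimator Φ ρ σw y s l n := by
  simp [closedForm, Finset.sum_apply]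

theorem measurable_closedForm_apply (K : ℕ) (Φ : Fin 2 → Matrix (Fin M) (Fin N) ℝ) (ρ : ℝ)
    (σw : Fin 2 → ℝ≥0) (l : Fin 2) (n : Fin N) :
    Measurable fun y => closedForm K Φ ρ σw y l n :=
  (measurable_pi_apply n).comp ((measurable_pi_apply l).comp (measurable_closedForm K Φ ρ σw))

/-- Each normalized weight is at most one. Square integrability thus follows from that of the linear
estimators, with no growth estimate for the exponential weights. -/
theorem abs_closedForm_le (K : ℕ) (Φ : Fin 2 → Matrix (Fin M) (Fin N) ℝ) (ρ : ℝ)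
    (σw : Fin 2 → ℝ≥0) (y : Fin M ⊕ Fin M → ℝ) (l : Fin 2) (n : Fin N) :
    |closedForm K Φ ρ σw y l n| ≤ ∑ s ∈ Finset.powersetCard K (Finset.univ : Finset (Fin N)),
      |oracleEstimator Φ ρ σw y s l n| := by
  set I := Finset.powersetCard K (Finset.univ : Finset (Fin N))
  have h0 : 0 ≤ ∑ s ∈ I, weight Φ ρ σw y s :=
    Finset.sum_nonneg fun s _ => (weight_pos Φ ρ σw y s).le
  rw [closedForm_apply, abs_mul, abs_of_nonneg (inv_nonneg.mpr h0)]
  refine inv_mul_le_of_le_mul₀ h0 (Finset.sum_nonneg fun _ _ => abs_nonneg _) ?_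
  rw [Finset.mul_sum]
  refine (Finset.abs_sum_le_sum_abs _ _).trans (Finset.sum_le_sum fun s hs => ?_)
  rw [abs_mul, abs_of_pos (weight_pos Φ ρ σw y s)]
  exact mul_le_mul_of_nonneg_right
    (Finset.single_le_sum (f := weight Φ ρ σw y) (fun t _ => (weight_pos Φ ρ σw y t).le) hs)
    (abs_nonneg _)

theorem IsModel.memLp_closedForm_cond (h : IsModel P K σθ σz σw Θ Z W)
    (Φ : Fin 2 → Matrix (Fin M) (Fin N) ℝ) (ρ : ℝ) {s : Finset (Fin N)} (hs : s.card = K)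
    (l : Fin 2) (n : Fin N) :
    MemLp (fun ω => closedForm K Φ ρ σw (measurement Φ Θ Z W ω) l n) 2
      (cond P {ω | supp (Θ ω) = s}) := by
  have hY := h.measurable_measurement Φ
  have hsum : MemLp (fun ω => ∑ t ∈ Finset.powersetCard K (Finset.univ : Finset (Fin N)),
      |oracleEstimator Φ ρ σw (measurement Φ Θ Z W ω) t l n|) 2
      (cond P {ω | supp (Θ ω) = s}) :=
    memLp_finsetSum _ fun t _ => (h.memLp_oracleEstimator_cond Φ ρ hs t l n).abs
  have hm : Measurable fun ω => closedForm K Φ ρ σw (measurement Φ Θ Z W ω) l n :=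
    (measurable_closedForm_apply K Φ ρ σw l n).comp hY
  refine hsum.mono hm.aestronglyMeasurable (ae_of_all _ fun ω => ?_)
  rw [Real.norm_eq_abs, Real.norm_eq_abs]
  exact (abs_closedForm_le K Φ ρ σw _ l n).trans (le_abs_self _)

theorem IsModel.memLp_source (h : IsModel P K σθ σz σw Θ Z W) (hKN : K ≤ N) (l : Fin 2)
    (n : Fin N) : MemLp (fun ω => source Θ Z l ω n) 2 P := by
  have h1 := h.measurable_common
  have h2 := h.measurable_innovation l
  exact h.memLp_two_of_cond hKN (by unfold source; fun_prop) fun _ hs => h.memLp_source_cond hs l n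

theorem IsModel.memLp_closedForm (h : IsModel P K σθ σz σw Θ Z W) (hKN : K ≤ N)
    (Φ : Fin 2 → Matrix (Fin M) (Fin N) ℝ) (ρ : ℝ) (l : Fin 2) (n : Fin N) :
    MemLp (fun ω => closedForm K Φ ρ σw (measurement Φ Θ Z W ω) l n) 2 P :=
  h.memLp_two_of_cond hKN
    ((measurable_closedForm_apply K Φ ρ σw l n).comp (h.measurable_measurement Φ))
    fun _ hs => h.memLp_closedForm_cond Φ ρ hs l n

theorem IsModel.setIntegral_source_cond (h : IsModel P K σθ σz σw Θ Z W)
    (Φ : Fin 2 → Matrix (Fin M) (Fin N) ℝ) (hρ : 0 < ρ) (hρθ : ρ / (1 + ρ) = (σθ : ℝ) ^ 2)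
    (hρz : 1 / (1 + ρ) = (σz : ℝ) ^ 2) (hσw : ∀ l, 0 < σw l) {s : Finset (Fin N)}
    (hs : s.card = K) (l : Fin 2) (n : Fin N) {S : Set (Fin M ⊕ Fin M → ℝ)}
    (hS : MeasurableSet S) :
    ∫ ω in measurement Φ Θ Z W ⁻¹' S, source Θ Z l ω n ∂(cond P {ω | supp (Θ ω) = s}) =
      ∫ ω in measurement Φ Θ Z W ⁻¹' S,
        oracleEstimator Φ ρ σw (measurement Φ Θ Z W ω) s l n ∂(cond P {ω | supp (Θ ω) = s}) := by
  have hσ : (σθ : ℝ) ^ 2 + (σz : ℝ) ^ 2 = 1 := by rw [← hρθ, ← hρz]; field_simp; ring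
  have hD := (posDef_matD Φ hρ σw hσw s).isUnit
  rw [isUnit_iff_isUnit_det] at hD
  have hcov := covariance_sourceMatrix Φ σθ σz ρ hρθ hρz σw s hD l
  -- With `D` rewritten as the covariance of the measurements, row `n` is the uncorrelatedness
  -- hypothesis needed below.
  rw [← covariance_measurementMatrix Φ σθ σz hσ ρ hρθ σw s, Matrix.mul_assoc (sourceMatrix N M l)]
    at hcov
  have key := setIntegral_dotProduct_eq_of_uncorrelated (coordVariance M σθ σz σw s)
    (measurementMatrix Φ) (sourceMatrix N M l n) (oracleMatrix Φ ρ σw s l n)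
    (by rw [← mul_apply_eq_vecMul, hcov, mul_apply_eq_vecMul]) hS
  have hB : Measurable fun x : (Fin N ⊕ (Fin N ⊕ Fin N)) ⊕ (Fin M ⊕ Fin M) → ℝ =>
      measurementMatrix Φ *ᵥ x := by fun_prop
  rw [← h.map_coords_cond hs,
    setIntegral_map (hB hS) (by fun_prop) h.measurable_coords.aemeasurable,
    setIntegral_map (hB hS) (by fun_prop) h.measurable_coords.aemeasurable] at key
  simp only [source_eq_mulVec Θ Z W l, oracleEstimator_eq_mulVec]
  simp only [Set.preimage_preimage, ← measurement_eq_mulVec Φ Θ Z W] at key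
  exact key

theorem IsModel.map_measurement_cond (h : IsModel P K σθ σz σw Θ Z W)
    (Φ : Fin 2 → Matrix (Fin M) (Fin N) ℝ) (hρ : 0 < ρ) (hρθ : ρ / (1 + ρ) = (σθ : ℝ) ^ 2)
    (hρz : 1 / (1 + ρ) = (σz : ℝ) ^ 2) (hσw : ∀ l, 0 < σw l) {s : Finset (Fin N)}
    (hs : s.card = K) :
    (cond P {ω | supp (Θ ω) = s}).map (measurement Φ Θ Z W) =
      volume.withDensity fun y => ENNReal.ofReal (gaussianDensity (matD Φ ρ σw s) y) := by
  have hσ : (σθ : ℝ) ^ 2 + (σz : ℝ) ^ 2 = 1 := by rw [← hρθ, ← hρz]; field_simp; ring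
  have hD := posDef_matD Φ hρ σw hσw s
  have hB : Measurable fun x : (Fin N ⊕ (Fin N ⊕ Fin N)) ⊕ (Fin M ⊕ Fin M) → ℝ =>
      measurementMatrix Φ *ᵥ x := by fun_prop
  have hc := covariance_measurementMatrix Φ σθ σz hσ ρ hρθ σw s
  rw [← hc] at hD ⊢
  rw [← map_mulVec_gaussianPi_eq_withDensity _ _ hD, ← h.map_coords_cond hs,
    Measure.map_map hB h.measurable_coords]
  exact congrArg (Measure.map · _) (funext (measurement_eq_mulVec Φ Θ Z W))

/-- The integral of a function of the measurements, given the support, in terms of the density. -/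
theorem setIntegral_comp_of_map_eq_withDensity {α β : Type*} [MeasurableSpace α]
    [MeasurableSpace β] {Q : Measure α} {μ : Measure β} {Y : α → β} (hY : Measurable Y)
    {p : β → ℝ} (hp : Measurable p) (hp0 : ∀ y, 0 ≤ p y)
    (hmap : Q.map Y = μ.withDensity fun y => ENNReal.ofReal (p y)) {f : β → ℝ} (hf : Measurable f)
    (hint : Integrable (fun a => f (Y a)) Q) {S : Set β} (hS : MeasurableSet S) :
    Integrable (fun y => p y * f y) μ ∧
      ∫ a in Y ⁻¹' S, f (Y a) ∂Q = ∫ y in S, p y * f y ∂μ := by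
  have hpm : Measurable fun y => ENNReal.ofReal (p y) := hp.ennreal_ofReal
  constructor
  · have h1 : Integrable f (Q.map Y) :=
      (integrable_map_measure hf.aestronglyMeasurable hY.aemeasurable).mpr hint
    rw [hmap, integrable_withDensity_iff_integrable_smul' hpm (ae_of_all _ fun _ => by simp)] at h1
    simpa only [ENNReal.toReal_ofReal (hp0 _), smul_eq_mul] using h1
  · rw [← setIntegral_map hS hf.aestronglyMeasurable hY.aemeasurable, hmap,
      setIntegral_withDensity_eq_setIntegral_toReal_smul hpm (ae_of_all _ fun _ => by simp) _ hS]
    simp only [ENNReal.toReal_ofReal (hp0 _), smul_eq_mul]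

/-- This is Bayes' rule in integrated form. Given each `s`, the source may be replaced by its
known-support estimator; both sides become Lebesgue integrals against the densities `p_s`, and
pointwise `(∑ p_s) * closedForm = ∑ p_s * oracleEstimator`. -/
theorem IsModel.setIntegral_source (h : IsModel P K σθ σz σw Θ Z W) (hKN : K ≤ N)
    (Φ : Fin 2 → Matrix (Fin M) (Fin N) ℝ) (hρ : 0 < ρ) (hρθ : ρ / (1 + ρ) = (σθ : ℝ) ^ 2)
    (hρz : 1 / (1 + ρ) = (σz : ℝ) ^ 2) (hσw : ∀ l, 0 < σw l) (l : Fin 2) (n : Fin N)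
    {S : Set (Fin M ⊕ Fin M → ℝ)} (hS : MeasurableSet S) :
    ∫ ω in measurement Φ Θ Z W ⁻¹' S, closedForm K Φ ρ σw (measurement Φ Θ Z W ω) l n ∂P =
      ∫ ω in measurement Φ Θ Z W ⁻¹' S, source Θ Z l ω n ∂P := by
  have hY := h.measurable_measurement Φ
  have hcard : ∀ s ∈ Finset.powersetCard K (Finset.univ : Finset (Fin N)), s.card = K :=
    fun s hs => (Finset.mem_powersetCard.mp hs).2
  rw [h.setIntegral_eq_sum_cond hKN (fun s hs => (h.memLp_closedForm_cond Φ ρ hs l n).integrable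
      (by norm_num)) (hY hS),
    h.setIntegral_eq_sum_cond hKN (fun s hs => (h.memLp_source_cond hs l n).integrable
      (by norm_num)) (hY hS),
    Finset.sum_congr rfl fun s hs =>
      h.setIntegral_source_cond Φ hρ hρθ hρz hσw (hcard s hs) l n hS]
  congr 1
  have hg := fun s hs => setIntegral_comp_of_map_eq_withDensity hY
    (measurable_gaussianDensity _) (gaussianDensity_nonneg _)
    (h.map_measurement_cond Φ hρ hρθ hρz hσw (hcard s hs))
    (f := fun y => closedForm K Φ ρ σw y l n)
    (measurable_closedForm_apply K Φ ρ σw l n)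
    ((h.memLp_closedForm_cond Φ ρ (hcard s hs) l n).integrable (by norm_num)) hS
  have ho := fun s hs => setIntegral_comp_of_map_eq_withDensity hY
    (measurable_gaussianDensity _) (gaussianDensity_nonneg _)
    (h.map_measurement_cond Φ hρ hρθ hρz hσw (hcard s hs))
    (f := fun y => oracleEstimator Φ ρ σw y s l n)
    (((continuous_apply n).comp ((continuous_apply l).comp
      (continuous_oracleEstimator Φ ρ σw s))).measurable)
    ((h.memLp_oracleEstimator_cond Φ ρ (hcard s hs) s l n).integrable (by norm_num)) hS
  rw [Finset.sum_congr rfl fun s hs => (hg s hs).2, Finset.sum_congr rfl fun s hs => (ho s hs).2,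
    ← integral_finsetSum _ fun s hs => (hg s hs).1.integrableOn,
    ← integral_finsetSum _ fun s hs => (ho s hs).1.integrableOn]
  congr 1 with y
  -- The factor `c` may depend on `y` but not on `s`, so it comes out of both sums.
  obtain ⟨c, hc, hw⟩ := gaussianDensity_matD Φ hρ σw hσw K y
  have hpos : 0 < ∑ s ∈ Finset.powersetCard K (Finset.univ : Finset (Fin N)),
      weight Φ ρ σw y s := by
    refine Finset.sum_pos (fun s _ => weight_pos Φ ρ σw y s) (Finset.powersetCard_nonempty.mpr ?_)
    simpa using hKN
  have h1 : ∑ s ∈ Finset.powersetCard K (Finset.univ : Finset (Fin N)),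
      gaussianDensity (matD Φ ρ σw s) y =
        c * ∑ s ∈ Finset.powersetCard K (Finset.univ : Finset (Fin N)), weight Φ ρ σw y s := by
    rw [Finset.mul_sum]
    exact Finset.sum_congr rfl fun s hs => hw s (hcard s hs)
  have h2 : ∑ s ∈ Finset.powersetCard K (Finset.univ : Finset (Fin N)),
      gaussianDensity (matD Φ ρ σw s) y * oracleEstimator Φ ρ σw y s l n =
        c * ∑ s ∈ Finset.powersetCard K (Finset.univ : Finset (Fin N)),
          weight Φ ρ σw y s * oracleEstimator Φ ρ σw y s l n := by
    rw [Finset.mul_sum]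
    exact Finset.sum_congr rfl fun s hs => by rw [hw s (hcard s hs), mul_assoc]
  rw [← Finset.sum_mul, h1, h2, closedForm_apply, mul_assoc, mul_inv_cancel_left₀ hpos.ne']

theorem IsModel.condExp_source_measurement (h : IsModel P K σθ σz σw Θ Z W) (hKN : K ≤ N)
    (Φ : Fin 2 → Matrix (Fin M) (Fin N) ℝ) (hρ : 0 < ρ) (hρθ : ρ / (1 + ρ) = (σθ : ℝ) ^ 2)
    (hρz : 1 / (1 + ρ) = (σz : ℝ) ^ 2) (hσw : ∀ l, 0 < σw l) (l : Fin 2) :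
    P[source Θ Z l | MeasurableSpace.comap (measurement Φ Θ Z W) inferInstance]
      =ᵐ[P] fun ω => closedForm K Φ ρ σw (measurement Φ Θ Z W ω) l := by
  have hY := h.measurable_measurement Φ
  have hX := fun n => (h.memLp_source hKN l n).integrable (by norm_num)
  have hg := fun n => (h.memLp_closedForm hKN Φ ρ l n).integrable (by norm_num)
  refine (ae_eq_condExp_of_forall_setIntegral_eq hY.comap_le (Integrable.of_eval hX)
    (fun A _ _ => (Integrable.of_eval hg).integrableOn) ?_ ?_).symm
  · rintro A ⟨S, hS, rfl⟩ -
    ext n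
    rw [eval_integral fun n => (hg n).integrableOn, eval_integral fun n => (hX n).integrableOn]
    exact h.setIntegral_source hKN Φ hρ hρθ hρz hσw l n hS
  · exact (((measurable_pi_apply l).comp (measurable_closedForm K Φ ρ σw)).comp
      (comap_measurable _)).aestronglyMeasurable

/-- Given support `s`, an event of the pair `(Y, supp Θ)` agrees almost surely with the event that
`Y` lies in its section at `s`, so the fixed-support identity applies to each term of the mixture.
-/
theorem IsModel.condExp_source_measurement_support (h : IsModel P K σθ σz σw Θ Z W)
    (hKN : K ≤ N) (Φ : Fin 2 → Matrix (Fin M) (Fin N) ℝ) (hρ : 0 < ρ)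
    (hρθ : ρ / (1 + ρ) = (σθ : ℝ) ^ 2) (hρz : 1 / (1 + ρ) = (σz : ℝ) ^ 2)
    (hσw : ∀ l, 0 < σw l) (l : Fin 2) :
    P[source Θ Z l | MeasurableSpace.comap (measurement Φ Θ Z W) inferInstance ⊔
        MeasurableSpace.comap (fun ω => supp (Θ ω)) ⊤]
      =ᵐ[P] fun ω => oracleEstimator Φ ρ σw (measurement Φ Θ Z W ω) (supp (Θ ω)) l := by
  let : MeasurableSpace (Finset (Fin N)) := ⊤
  have hY := h.measurable_measurement Φ
  have hsupp : Measurable fun ω => supp (Θ ω) := measurable_supp.comp h.measurable_common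
  have hX := fun n => (h.memLp_source hKN l n).integrable (by norm_num)
  -- Joint measurability needs only continuity in `y` for each `s`, since there are countably many
  -- supports.
  have hom : Measurable fun p : (Fin M ⊕ Fin M → ℝ) × Finset (Fin N) =>
      oracleEstimator Φ ρ σw p.1 p.2 l :=
    measurable_from_prod_countable_left fun s =>
      ((continuous_apply l).comp (continuous_oracleEstimator Φ ρ σw s)).measurable
  have hae : ∀ s, ∀ᵐ ω ∂(cond P {ω | supp (Θ ω) = s}), supp (Θ ω) = s := fun s =>
    ae_cond_mem (h.measurableSet_support s)
  have hoc : ∀ n (s : Finset (Fin N)), s.card = K → Integrable (fun ω =>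
      oracleEstimator Φ ρ σw (measurement Φ Θ Z W ω) (supp (Θ ω)) l n)
      (cond P {ω | supp (Θ ω) = s}) := fun n s hs => by
    refine ((h.memLp_oracleEstimator_cond Φ ρ hs s l n).integrable (by norm_num)).congr ?_
    filter_upwards [hae s] with ω hω
    rw [hω]
  have ho := fun n => h.integrable_of_cond hKN (hoc n)
  rw [← MeasurableSpace.comap_prodMk]
  have hYS := hY.prodMk hsupp
  refine (ae_eq_condExp_of_forall_setIntegral_eq hYS.comap_le (Integrable.of_eval hX)
    (fun A _ _ => (Integrable.of_eval ho).integrableOn) ?_ ?_).symm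
  · rintro A ⟨B, hB, rfl⟩ -
    ext n
    rw [eval_integral fun n => (ho n).integrableOn, eval_integral fun n => (hX n).integrableOn,
      h.setIntegral_eq_sum_cond hKN (hoc n) (hYS hB), h.setIntegral_eq_sum_cond hKN
        (fun s hs => (h.memLp_source_cond hs l n).integrable (by norm_num)) (hYS hB)]
    congr 1
    refine Finset.sum_congr rfl fun s hs => ?_
    have hs' := (Finset.mem_powersetCard.mp hs).2
    have hBs : MeasurableSet {y | (y, s) ∈ B} := measurable_prodMk_right hB
    have hset : (fun ω => (measurement Φ Θ Z W ω, supp (Θ ω))) ⁻¹' B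
        =ᵐ[cond P {ω | supp (Θ ω) = s}] measurement Φ Θ Z W ⁻¹' {y | (y, s) ∈ B} := by
      filter_upwards [hae s] with ω hω
      refine propext ?_
      change (_, supp (Θ ω)) ∈ B ↔ (_, s) ∈ B
      rw [hω]
    rw [setIntegral_congr_set hset, setIntegral_congr_set hset,
      h.setIntegral_source_cond Φ hρ hρθ hρz hσw hs' l n hBs]
    refine integral_congr_ae (ae_restrict_of_ae ?_)
    filter_upwards [hae s] with ω hω
    rw [hω]
  · exact (hom.comp (comap_measurable _)).aestronglyMeasurable

end ConditionalMean

/-! ### Least distortion and uniqueness of the minimizer. -/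

section Distortion

/-- Pythagoras for the conditional mean, valued in `[0, ∞]`. -/
theorem lintegral_sq_sub_eq_add_of_condExp {Ω : Type*} {m mΩ : MeasurableSpace Ω} {P : Measure Ω}
    [IsProbabilityMeasure P] {x g f : Ω → ℝ} (hx : MemLp x 2 P) (hg : MemLp g 2 P)
    (hgc : P[x | m] =ᵐ[P] g) (hgm : Measurable[m] g) (hfm : Measurable[m] f) (hm : m ≤ mΩ) :
    ∫⁻ ω, ENNReal.ofReal ((x ω - f ω) ^ 2) ∂P =
      ∫⁻ ω, ENNReal.ofReal ((x ω - g ω) ^ 2) ∂P + ∫⁻ ω, ENNReal.ofReal ((g ω - f ω) ^ 2) ∂P := by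
  have hsq : ∀ {u : Ω → ℝ}, MemLp u 2 P →
      ∫⁻ ω, ENNReal.ofReal (u ω ^ 2) ∂P = ENNReal.ofReal (∫ ω, u ω ^ 2 ∂P) := fun {_} hu =>
    (ofReal_integral_eq_lintegral_ofReal hu.integrable_sq (ae_of_all _ fun _ => sq_nonneg _)).symm
  have hnot : ∀ {u : Ω → ℝ}, AEStronglyMeasurable[mΩ] u P → ¬ MemLp u 2 P →
      ∫⁻ ω, ENNReal.ofReal (u ω ^ 2) ∂P = ⊤ := fun {u} hum hu => by
    by_contra hne
    refine hu ((memLp_two_iff_integrable_sq hum).mpr ?_)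
    exact (lintegral_ofReal_ne_top_iff_integrable (hum.pow 2)
      (ae_of_all _ fun _ => sq_nonneg _)).mp hne
  have hfm' : AEStronglyMeasurable[mΩ] f P := (hfm.mono hm le_rfl).aestronglyMeasurable
  by_cases hf : MemLp f 2 P
  · have hxg := hx.sub hg
    have hgf := hg.sub hf
    -- The cross term vanishes: `g - f` is `m`-measurable and pulls out of the conditional
    -- expectation, while `x - g` has conditional mean zero.
    have h0 : ∫ ω, (x ω - g ω) * (g ω - f ω) ∂P = 0 := by
      have h1 : P[(x - g) * (g - f) | m] =ᵐ[P] P[x - g | m] * (g - f) :=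
        condExp_mul_of_stronglyMeasurable_right (hgm.sub hfm).stronglyMeasurable
          (hxg.integrable_mul hgf) (hxg.integrable (by norm_num))
      have h2 : P[x - g | m] =ᵐ[P] 0 := by
        refine (condExp_sub (hx.integrable (by norm_num)) (hg.integrable (by norm_num)) m).trans ?_
        rw [condExp_of_stronglyMeasurable hm hgm.stronglyMeasurable (hg.integrable (by norm_num))]
        filter_upwards [hgc] with ω hω
        simp [hω]
      change ∫ ω, ((x - g) * (g - f)) ω ∂P = 0
      rw [← integral_condExp hm, integral_eq_zero_of_ae]
      filter_upwards [h1, h2] with ω h1 h2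
      rw [h1, Pi.mul_apply, h2, Pi.zero_apply, zero_mul]
    have e1 := hsq (hx.sub hf)
    have e2 := hsq hxg
    have e3 := hsq hgf
    simp only [Pi.sub_apply] at e1 e2 e3
    rw [e1, e2, e3, ← ENNReal.ofReal_add (integral_nonneg fun _ => sq_nonneg _)
      (integral_nonneg fun _ => sq_nonneg _)]
    congr 1
    have hi1 : Integrable (fun ω => (x ω - g ω) ^ 2) P := hxg.integrable_sq
    have hi2 : Integrable (fun ω => (g ω - f ω) ^ 2) P := hgf.integrable_sq
    have hi12 : Integrable (fun ω => (x ω - g ω) ^ 2 + (g ω - f ω) ^ 2) P := hi1.add hi2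
    have hi3 : Integrable (fun ω => (x ω - g ω) * (g ω - f ω)) P := hxg.integrable_mul hgf
    have hexp : ∀ ω, (x ω - f ω) ^ 2 =
        (x ω - g ω) ^ 2 + (g ω - f ω) ^ 2 + 2 * ((x ω - g ω) * (g ω - f ω)) := fun ω => by ring
    simp only [hexp]
    rw [integral_add hi12 (hi3.const_mul 2), integral_add hi1 hi2, integral_const_mul, h0,
      mul_zero, add_zero]
  -- If `f` is not square integrable, neither `x - f` nor `g - f` is, and both sides are infinite.
  · have h1 := hnot (hx.aestronglyMeasurable.sub hfm') fun h => hf (by simpa using hx.sub h)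
    have h2 := hnot (hg.aestronglyMeasurable.sub hfm') fun h => hf (by simpa using hg.sub h)
    simp only [Pi.sub_apply] at h1 h2
    rw [h1, h2, add_top]

theorem lintegral_norm_sq_toLp_eq_sum {Ω : Type*} [MeasurableSpace Ω] {P : Measure Ω} {N : ℕ}
    {u : Ω → Fin N → ℝ} (hu : Measurable u) :
    ∫⁻ ω, ENNReal.ofReal (‖WithLp.toLp 2 (u ω)‖ ^ 2) ∂P =
      ∑ n, ∫⁻ ω, ENNReal.ofReal (u ω n ^ 2) ∂P := by
  rw [← lintegral_finsetSum _ fun n _ => by fun_prop]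
  refine lintegral_congr fun ω => ?_
  rw [EuclideanSpace.norm_sq_eq, ENNReal.ofReal_sum_of_nonneg fun _ _ => sq_nonneg _]
  simp

variable {Ω : Type*} [MeasurableSpace Ω] {P : Measure Ω} {N M K : ℕ}
  {X : Fin 2 → Ω → Fin N → ℝ} {Y : Ω → Fin M ⊕ Fin M → ℝ}

theorem distortion_eq_sum (hX : ∀ l, Measurable (X l)) (hY : Measurable Y)
    {f : (Fin M ⊕ Fin M → ℝ) → Fin 2 → Fin N → ℝ} (hf : Measurable f) :
    distortion P K X Y f = (2 * (K : ℝ≥0∞))⁻¹ *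
      ∑ l, ∑ n, ∫⁻ ω, ENNReal.ofReal ((X l ω n - f (Y ω) l n) ^ 2) ∂P := by
  have hfl : ∀ l, Measurable fun ω => f (Y ω) l := fun l =>
    (measurable_pi_apply l).comp (hf.comp hY)
  unfold distortion
  congr 1
  exact Finset.sum_congr rfl fun l _ => lintegral_norm_sq_toLp_eq_sum ((hX l).sub (hfl l))

/-- The conditional mean minimizes the distortion, and is the only minimizer up to null sets. -/
theorem distortion_condExp_le [IsProbabilityMeasure P] (hK : 1 ≤ K) (hXm : ∀ l, Measurable (X l))
    (hX : ∀ l n, MemLp (fun ω => X l ω n) 2 P) (hY : Measurable Y)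
    {g : (Fin M ⊕ Fin M → ℝ) → Fin 2 → Fin N → ℝ} (hgm : Measurable g)
    (hg : ∀ l n, MemLp (fun ω => g (Y ω) l n) 2 P)
    (hgc : ∀ l n, P[fun ω => X l ω n | MeasurableSpace.comap Y inferInstance]
      =ᵐ[P] fun ω => g (Y ω) l n)
    {f : (Fin M ⊕ Fin M → ℝ) → Fin 2 → Fin N → ℝ} (hf : Measurable f) :
    distortion P K X Y g ≤ distortion P K X Y f ∧
      (distortion P K X Y f = distortion P K X Y g → ∀ᵐ ω ∂P, f (Y ω) = g (Y ω)) := by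
  have happ : ∀ {u : (Fin M ⊕ Fin M → ℝ) → Fin 2 → Fin N → ℝ}, Measurable u → ∀ l n,
      Measurable fun y => u y l n := fun hu l n =>
    (measurable_pi_apply n).comp ((measurable_pi_apply l).comp hu)
  have hpyth := fun l n => lintegral_sq_sub_eq_add_of_condExp (hX l n) (hg l n) (hgc l n)
    ((happ hgm l n).comp (comap_measurable Y)) ((happ hf l n).comp (comap_measurable Y))
    hY.comap_le
  have hsplit : distortion P K X Y f = distortion P K X Y g + (2 * (K : ℝ≥0∞))⁻¹ *
      ∑ l, ∑ n, ∫⁻ ω, ENNReal.ofReal ((g (Y ω) l n - f (Y ω) l n) ^ 2) ∂P := by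
    rw [distortion_eq_sum hXm hY hf, distortion_eq_sum hXm hY hgm, ← mul_add,
      ← Finset.sum_add_distrib]
    simp only [← Finset.sum_add_distrib]
    congr 1
    exact Finset.sum_congr rfl fun l _ => Finset.sum_congr rfl fun n _ => hpyth l n
  refine ⟨hsplit ▸ le_self_add, fun heq => ?_⟩
  -- Cancelling in `[0, ∞]` requires the minimal distortion to be finite; `1 ≤ K` keeps the factor
  -- `(2K)⁻¹` finite.
  have hfin : distortion P K X Y g ≠ ⊤ := by
    rw [distortion_eq_sum hXm hY hgm]
    refine ENNReal.mul_ne_top (ENNReal.inv_ne_top.mpr ?_) ?_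
    · simpa using Nat.one_le_iff_ne_zero.mp hK
    · refine ENNReal.sum_ne_top.mpr fun l _ => ENNReal.sum_ne_top.mpr fun n _ => ?_
      have hi : Integrable (fun ω => (X l ω n - g (Y ω) l n) ^ 2) P :=
        ((hX l n).sub (hg l n)).integrable_sq
      rw [← ofReal_integral_eq_lintegral_ofReal hi (ae_of_all _ fun _ => sq_nonneg _)]
      exact ENNReal.ofReal_ne_top
  have hzero : (2 * (K : ℝ≥0∞))⁻¹ *
      ∑ l, ∑ n, ∫⁻ ω, ENNReal.ofReal ((g (Y ω) l n - f (Y ω) l n) ^ 2) ∂P = 0 :=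
    (ENNReal.add_right_inj hfin).mp (by rw [← hsplit, heq, add_zero])
  have hKinv : (2 * (K : ℝ≥0∞))⁻¹ ≠ 0 :=
    ENNReal.inv_ne_zero.mpr (ENNReal.mul_ne_top (by simp) (ENNReal.natCast_ne_top K))
  have hsum := (mul_eq_zero.mp hzero).resolve_left hKinv
  have hae : ∀ l n, ∀ᵐ ω ∂P, f (Y ω) l n = g (Y ω) l n := fun l n => by
    have hz := Finset.sum_eq_zero_iff.mp (Finset.sum_eq_zero_iff.mp hsum l (Finset.mem_univ l)) n
      (Finset.mem_univ n)
    have h1 : Measurable fun ω => g (Y ω) l n := (happ hgm l n).comp hY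
    have h2 : Measurable fun ω => f (Y ω) l n := (happ hf l n).comp hY
    have h5 : Measurable fun ω => ENNReal.ofReal ((g (Y ω) l n - f (Y ω) l n) ^ 2) :=
      ((h1.sub h2).pow_const 2).ennreal_ofReal
    rw [lintegral_eq_zero_iff h5] at hz
    filter_upwards [hz] with ω hω
    have h3 : (g (Y ω) l n - f (Y ω) l n) ^ 2 ≤ 0 := ENNReal.ofReal_eq_zero.mp hω
    have h4 := pow_eq_zero_iff (two_ne_zero) |>.mp (le_antisymm h3 (sq_nonneg _))
    linarith
  filter_upwards [ae_all_iff.mpr fun l => ae_all_iff.mpr (hae l)] with ω hω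
  ext l n
  exact hω l n

end Distortion

end JSM

/-! ### The main theorem. -/

theorem proposition1 {Ω : Type*} [MeasurableSpace Ω] (P : Measure Ω) [IsProbabilityMeasure P]
    (N M K : ℕ) (hK : 1 ≤ K) (hKN : K ≤ N)
    (σθ σz : ℝ≥0) (hσθ : 0 < σθ) (hσz : 0 < σz) (hσ : σθ ^ 2 + σz ^ 2 = 1)
    (ρ : ℝ) (hρ : ρ = (σθ : ℝ) ^ 2 / (σz : ℝ) ^ 2)
    (σw : Fin 2 → ℝ≥0) (hσw : ∀ l, 0 < σw l)
    (Φ : Fin 2 → Matrix (Fin M) (Fin N) ℝ)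
    (Θ : Ω → Fin N → ℝ) (Z : Fin 2 → Ω → Fin N → ℝ) (W : Fin 2 → Ω → Fin M → ℝ)
    (hmodel : JSM.IsModel P K σθ σz σw Θ Z W)
    (X : Fin 2 → Ω → Fin N → ℝ) (hX : X = JSM.source Θ Z)
    (Y : Ω → Fin M ⊕ Fin M → ℝ) (hY : Y = JSM.measurement Φ Θ Z W) :
    -- the inverses and the logarithms in the closed form are genuine
    (∀ s : Finset (Fin N), s.card = K →
      IsUnit (JSM.matD Φ ρ σw s).det ∧ IsUnit (JSM.matN M σw).det ∧
      IsUnit (JSM.matE ρ s).det ∧ 0 < (JSM.matG Φ ρ σw s).det) ∧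
    -- the sources are square integrable
    (∀ l, MemLp (X l) 2 P) ∧
    -- the conditional mean of the sources given the measurements and the support
    (∀ l, P[X l | MeasurableSpace.comap Y inferInstance ⊔
          MeasurableSpace.comap (fun ω => JSM.supp (Θ ω)) ⊤]
        =ᵐ[P] fun ω => JSM.oracleEstimator Φ ρ σw (Y ω) (JSM.supp (Θ ω)) l) ∧
    -- the conditional mean of the sources given the measurements
    (∀ l, P[X l | MeasurableSpace.comap Y inferInstance]
        =ᵐ[P] fun ω => JSM.closedForm K Φ ρ σw (Y ω) l) ∧
    -- it is the estimator of least distortion, and the only one up to null sets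
    Measurable (JSM.closedForm K Φ ρ σw) ∧
    ∀ f : (Fin M ⊕ Fin M → ℝ) → Fin 2 → Fin N → ℝ, Measurable f →
      JSM.distortion P K X Y (JSM.closedForm K Φ ρ σw) ≤ JSM.distortion P K X Y f ∧
      (JSM.distortion P K X Y f = JSM.distortion P K X Y (JSM.closedForm K Φ ρ σw) →
        ∀ᵐ ω ∂P, f (Y ω) = JSM.closedForm K Φ ρ σw (Y ω)) := by
  have hz0 : (0 : ℝ) < (σz : ℝ) ^ 2 := by positivity
  have hθ0 : (0 : ℝ) < (σθ : ℝ) ^ 2 := by positivity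
  have hσ' : (σθ : ℝ) ^ 2 + (σz : ℝ) ^ 2 = 1 := by exact_mod_cast hσ
  have hρ0 : 0 < ρ := by rw [hρ]; positivity
  -- The normalization `σθ² + σz² = 1` makes the coefficients in `C`, `D`, `E` the actual variances.
  have hρ1 : 1 + ρ = 1 / (σz : ℝ) ^ 2 := by
    rw [hρ, eq_div_iff hz0.ne', add_mul, div_mul_cancel₀ _ hz0.ne']
    linarith
  have hρz : 1 / (1 + ρ) = (σz : ℝ) ^ 2 := by rw [hρ1, one_div_one_div]
  have hρθ : ρ / (1 + ρ) = (σθ : ℝ) ^ 2 := by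
    rw [hρ1, hρ]
    field_simp
  subst hX hY
  have hYm := hmodel.measurable_measurement Φ
  have hXm : ∀ l, Measurable (JSM.source Θ Z l) := fun l =>
    hmodel.measurable_common.add (hmodel.measurable_innovation l)
  have hXL := hmodel.memLp_source hKN
  have hcond := hmodel.condExp_source_measurement hKN Φ hρ0 hρθ hρz hσw
  -- Pythagoras is applied to scalars; coordinate projections commute with conditional expectation.
  have hcond' : ∀ l n, P[fun ω => JSM.source Θ Z l ω n |
      MeasurableSpace.comap (JSM.measurement Φ Θ Z W) inferInstance] =ᵐ[P]
      fun ω => JSM.closedForm K Φ ρ σw (JSM.measurement Φ Θ Z W ω) l n := fun l n => by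
    have hproj := (ContinuousLinearMap.proj (R := ℝ) (φ := fun _ : Fin N => ℝ) n).comp_condExp_comm
      (m := MeasurableSpace.comap (JSM.measurement Φ Θ Z W) inferInstance)
      ((MemLp.of_eval (hXL l)).integrable (by norm_num : (1 : ℝ≥0∞) ≤ 2))
    refine hproj.symm.trans ?_
    filter_upwards [hcond l] with ω hω
    simp [hω]
  refine ⟨fun s _ => ⟨?_, ?_, ?_, (JSM.posDef_matG Φ hρ0 σw hσw s).det_pos⟩,
    fun l => MemLp.of_eval (hXL l),
    hmodel.condExp_source_measurement_support hKN Φ hρ0 hρθ hρz hσw, hcond,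
    JSM.measurable_closedForm K Φ ρ σw, fun f hf => ?_⟩
  · exact (JSM.posDef_matD Φ hρ0 σw hσw s).det_pos.ne'.isUnit
  · exact (JSM.posDef_matN σw hσw).det_pos.ne'.isUnit
  · exact (JSM.posDef_matE hρ0 s).det_pos.ne'.isUnit
  · exact JSM.distortion_condExp_le hK hXm hXL hYm (JSM.measurable_closedForm K Φ ρ σw)
      (hmodel.memLp_closedForm hKN Φ ρ) hcond' hf
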